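/- For $d\ge 1$, $\boldsymbol m\in\mathbb R^d$, a positive definite $d\times d$ matrix $S$ and $\nu>2$, let $t_d(\boldsymbol m,S,\nu)$ denote Student's $t$-distribution with mean $\boldsymbol m$, covariance matrix $S$ and $\nu$ degrees of freedom, i.e. the distribution on $\mathbb R^d$ with density $$\frac{\Gamma((d+\nu)/2)}{(\pi(\nu-2))^{d/2}\,\Gamma(\nu/2)}\det(S)^{-1/2}\Bigl(1+\tfrac{1}{\nu-2}(\boldsymbol x-\boldsymbol m)'S^{-1}(\boldsymbol x-\boldsymbol m)\Bigr)^{-(d+\nu)/2}.$$ Let $p\ge 1$, $\varphi_0\in\mathbb R$, $\sigma>0$, $\nu>2$, and let $\boldsymbol\varphi=(\varphi_1,\dots,\varphi_p)\in\mathbb S^p$, that is, $\boldsymbol\varphi\in\mathbb R^p$ and $1-\sum_{i=1}^p\varphi_i z^i\ne 0$ for all $z\in\mathbb C$ with $|z|\le 1$. Let $\Phi$ be the $p\times p$ companion matrix with first row $(\varphi_1,\dots,\varphi_p)$ and with $[I_{p-1}\ \ \mathbf 0]$ below it, and define $\Gamma_p$, $\Gamma_{p+1}$ and $\mu$ by $$\mathrm{vec}(\Gamma_p)=(I_{p^2}-\Phi\otimes\Phi)^{-1}(\sigma^2,0,\dots,0)',\quad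 \gamma_0=\sigma^2+\boldsymbol\varphi'\Gamma_p\boldsymbol\varphi,\quad \boldsymbol\gamma_p=\Gamma_p\boldsymbol\varphi,\quad \Gamma_{p+1}=\begin{bmatrix}\gamma_0&\boldsymbol\gamma_p'\\ \boldsymbol\gamma_p&\Gamma_p\end{bmatrix},\quad \mu=\frac{\varphi_0}{1-\varphi_1-\cdots-\varphi_p}.$$ For $\boldsymbol x\in\mathbb R^p$ let $$\mu(\boldsymbol x)=\varphi_0+\boldsymbol\varphi'\boldsymbol x,\qquad \sigma^2(\boldsymbol x)=\frac{\nu-2+(\boldsymbol x-\mu\mathbf 1_p)'\Gamma_p^{-1}(\boldsymbol x-\mu\mathbf 1_p)}{\nu-2+p}\,\sigma^2 .$$ Then $\Gamma_p$ and $\Gamma_{p+1}$ are positive definite, and there is a real-valued process $z_t$ ($t=1-p,2-p,\dots$) for which, with $\boldsymbol z_t=(z_t,\dots,z_{t-p+1})$ for $t\ge 0$ and $\boldsymbol z_t^+=(z_t,\boldsymbol z_{t-1})$ for $t\ge 1$, the following holds. (i) For every initial distribution of $\boldsymbol z_0$, the process $\boldsymbol z_t$ ($t=0,1,2,\dots$)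 is a time-homogeneous Markov chain on $\mathbb R^p$; it moves from $\boldsymbol x=(x_1,\dots,x_p)$ to $(u,x_1,\dots,x_{p-1})$ with $u\sim t_1(\mu(\boldsymbol x),\sigma^2(\boldsymbol x),\nu+p)$, and $t_p(\mu\mathbf 1_p,\Gamma_p,\nu)$ is a stationary distribution of it. When $\boldsymbol z_0\sim t_p(\mu\mathbf 1_p,\Gamma_p,\nu)$, we have for all $t\ge 1$ that $\boldsymbol z_t\sim t_p(\mu\mathbf 1_p,\Gamma_p,\nu)$ and $\boldsymbol z_t^+\sim t_{p+1}(\mu\mathbf 1_{p+1},\Gamma_{p+1},\nu)$, that the conditional distribution of $z_t$ given $\boldsymbol z_{t-1}$ is $t_1(\mu(\boldsymbol z_{t-1}),\sigma^2(\boldsymbol z_{t-1}),\nu+p)$, and that $z_t$ is square integrable with $E[z_t\mid z_s,\ s<t]=\mu(\boldsymbol z_{t-1})$ and $\mathrm{Var}[z_t\mid z_s,\ s<t]=\sigma^2(\boldsymbol z_{t-1})$ almost surely. (ii) For all $t\ge 1$, $$z_t=\varphi_0+\sum_{i=1}^p\varphi_i z_{t-i}+\sigma_t\varepsilon_t,\qquad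 \sigma_t=\sqrt{\sigma^2(\boldsymbol z_{t-1})}>0,$$ where, for every initial distribution of $\boldsymbol z_0$, the random variables $\varepsilon_t$ ($t\ge 1$) are independent and identically distributed with distribution $t_1(0,1,\nu+p)$, and $\varepsilon_t$ is independent of $\{z_s,\ s<t\}$ for every $t\ge 1$. -/

import Mathlib

open MeasureTheory ProbabilityTheory
open scoped Matrix Kronecker

noncomputable section

/-! ### Student's t-distribution, parametrized by mean and covariance matrix -/

/-- Density of the `d`-dimensional Student's t-distribution `t_d(m, S, ν)`, where `d` is the
cardinality of the index type, `m` is the mean, `S` the (positive definite) covariance matrix and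
`ν > 2` the degrees of freedom. -/
def studentTPDF {ι : Type*} [Fintype ι] [DecidableEq ι]
    (m : ι → ℝ) (S : Matrix ι ι ℝ) (ν : ℝ) (x : ι → ℝ) : ℝ :=
  Real.Gamma (((Fintype.card ι : ℝ) + ν) / 2) /
      ((Real.pi * (ν - 2)) ^ ((Fintype.card ι : ℝ) / 2) * Real.Gamma (ν / 2)) *
    S.det ^ (-(1 / 2) : ℝ) *
    (1 + (ν - 2)⁻¹ * ((x - m) ⬝ᵥ (S⁻¹ *ᵥ (x - m)))) ^ (-(((Fintype.card ι : ℝ) + ν) / 2))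

/-- The distribution `t_d(m, S, ν)` on `ℝ^d`. -/
def studentT {ι : Type*} [Fintype ι] [DecidableEq ι]
    (m : ι → ℝ) (S : Matrix ι ι ℝ) (ν : ℝ) : Measure (ι → ℝ) :=
  volume.withDensity fun x => ENNReal.ofReal (studentTPDF m S ν x)

/-- Density of the univariate Student's t-distribution `t_1(m, s2, ν)` with mean `m`,
variance `s2` and `ν` degrees of freedom: the case `d = 1` of `studentTPDF`. -/
def studentT1PDF (m s2 ν : ℝ) (x : ℝ) : ℝ :=
  Real.Gamma ((1 + ν) / 2) / ((Real.pi * (ν - 2)) ^ (1 / 2 : ℝ) * Real.Gamma (ν / 2)) *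
    s2 ^ (-(1 / 2) : ℝ) *
    (1 + (ν - 2)⁻¹ * ((x - m) * (s2⁻¹ * (x - m)))) ^ (-((1 + ν) / 2))

/-- The distribution `t_1(m, s2, ν)` on `ℝ`. -/
def studentT1 (m s2 ν : ℝ) : Measure ℝ :=
  volume.withDensity fun x => ENNReal.ofReal (studentT1PDF m s2 ν x)

/-! ### Quantities attached to a linear autoregression of order `p`

The coefficient `φ_i` (`i = 1, …, p`) is `φ (i - 1)`, indices in `Fin p` being zero-based. -/

/-- The stationarity region `𝕊^p`. -/
def stationarityRegion (p : ℕ) : Set (Fin p → ℝ) :=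
  {φ | ∀ z : ℂ, ‖z‖ ≤ 1 → 1 - ∑ i : Fin p, (φ i : ℂ) * z ^ ((i : ℕ) + 1) ≠ 0}

/-- The companion matrix `Φ`: its first row is `φ`, below it stands `[I_{p-1}, 0]`. -/
def arCompanion {p : ℕ} (φ : Fin p → ℝ) : Matrix (Fin p) (Fin p) ℝ :=
  Matrix.of fun i j =>
    if (i : ℕ) = 0 then φ j else if (i : ℕ) = (j : ℕ) + 1 then 1 else 0

/-- The matrix `Γ_p`, given by `vec Γ_p = (I - Φ ⊗ Φ)⁻¹ ι σ²` with `ι = (1, 0, …, 0)`; the entry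
of `vec Γ_p` that belongs to row `i` and column `j` has index `(j, i)`, as in `Matrix.vec`. -/
def arCov {p : ℕ} (φ : Fin p → ℝ) (σ : ℝ) : Matrix (Fin p) (Fin p) ℝ :=
  Matrix.of fun i j =>
    ((1 - arCompanion φ ⊗ₖ arCompanion φ)⁻¹ *ᵥ
      (fun k : Fin p × Fin p =>
        if (k.1 : ℕ) = 0 ∧ (k.2 : ℕ) = 0 then σ ^ 2 else 0)) (j, i)

/-- The vector `γ_p = Γ_p φ`. -/
def arAutocov {p : ℕ} (φ : Fin p → ℝ) (σ : ℝ) : Fin p → ℝ :=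
  arCov φ σ *ᵥ φ

/-- The number `γ_0 = σ² + φ' Γ_p φ`. -/
def arVar {p : ℕ} (φ : Fin p → ℝ) (σ : ℝ) : ℝ :=
  σ ^ 2 + φ ⬝ᵥ (arCov φ σ *ᵥ φ)

/-- The matrix `Γ_{p+1}` with blocks `γ_0`, `γ_p'`, `γ_p`, `Γ_p`. -/
def arCovSucc {p : ℕ} (φ : Fin p → ℝ) (σ : ℝ) : Matrix (Fin (p + 1)) (Fin (p + 1)) ℝ :=
  Matrix.of (Matrix.vecCons (Matrix.vecCons (arVar φ σ) (arAutocov φ σ))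
    fun i => Matrix.vecCons (arAutocov φ σ i) (arCov φ σ i))

/-- The mean `μ = φ_0 / (1 - φ_1 - ⋯ - φ_p)`. -/
def arMean {p : ℕ} (φ₀ : ℝ) (φ : Fin p → ℝ) : ℝ :=
  φ₀ / (1 - ∑ i, φ i)

/-- The conditional mean function `μ(x) = φ_0 + φ' x`. -/
def condMeanFun {p : ℕ} (φ₀ : ℝ) (φ : Fin p → ℝ) (x : Fin p → ℝ) : ℝ :=
  φ₀ + φ ⬝ᵥ x

/-- The conditional variance function
`σ²(x) = (ν - 2 + (x - μ 1_p)' Γ_p⁻¹ (x - μ 1_p)) / (ν - 2 + p) · σ²`. -/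
def condVarFun {p : ℕ} (φ₀ : ℝ) (φ : Fin p → ℝ) (σ ν : ℝ) (x : Fin p → ℝ) : ℝ :=
  (ν - 2 + (x - fun _ => arMean φ₀ φ) ⬝ᵥ ((arCov φ σ)⁻¹ *ᵥ (x - fun _ => arMean φ₀ φ))) /
    (ν - 2 + (p : ℝ)) * σ ^ 2

/-! ### Processes -/

/-- The vector `(z_t, z_{t-1}, …, z_{t-p+1})` of `p` consecutive values of a scalar process. -/
def lagVec {Ω : Type*} (p : ℕ) (z : ℤ → Ω → ℝ) (t : ℤ) (ω : Ω) : Fin p → ℝ :=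
  fun i => z (t - ((i : ℕ) : ℤ)) ω

/-- The σ-algebra generated by `z_s`, `s < t`, for a scalar process whose first time is
`1 - p`. -/
abbrev pastSigma {Ω : Type*} (p : ℕ) (z : ℤ → Ω → ℝ) (t : ℤ) : MeasurableSpace Ω :=
  ⨆ s ∈ Set.Ico (1 - (p : ℤ)) t, MeasurableSpace.comap (z s) inferInstance

/-- `X_0, X_1, …` is a time-homogeneous Markov chain under `P` with transition probabilities `κ`:
the conditional probability of `X_{t+1} ∈ A` given `X_0, …, X_t` is `κ(X_t, A)`. -/
structure IsMarkovChain {Ω E : Type*} [MeasurableSpace Ω] [MeasurableSpace E]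
    (κ : Kernel E E) (X : ℕ → Ω → E) (P : Measure Ω) : Prop where
  measurable : ∀ t, Measurable (X t)
  condProb : ∀ (t : ℕ) (A : Set E), MeasurableSet A →
    P[(X (t + 1) ⁻¹' A).indicator (fun _ => (1 : ℝ)) |
        ⨆ s ∈ Set.Iic t, MeasurableSpace.comap (X s) inferInstance]
      =ᵐ[P] fun ω => (κ (X t ω)).real A

end

/-! The core is a factorization of the t-density (`studentTPDF_cons`). Write the covariance matrix
of `(u, x)` in regression form, with coefficients `b` of `u` on `x` and residual variance `s`
(`schurCov`). Then the joint density is the t-density of `x` times a univariate t-density of `u`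
whose mean is affine in `x`, whose variance is affine in the quadratic form of `x`, and whose
degrees of freedom grow by the dimension of `x`. Since `Γ_{p+1}` has this form with `b = φ` and `s =
σ²`, the second factor is exactly the prescribed transition law, and one step from `t_p(μ1, Γ_p, ν)`
gives `t_{p+1}(μ1, Γ_{p+1}, ν)` for `z_t^+`.

Stationarity requires the newest `p` coordinates of `z_t^+` to be `t_p` again, while the
factorization only yields the marginal of the oldest `p`. The Lyapunov equation `Γ = ΦΓΦ' + σ²
e₁e₁'` makes `Γ_{p+1}` a symmetric Toeplitz matrix (`arCovSucc_castSucc_castSucc`), so the law of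
`z_t^+` is invariant under time reversal, which exchanges the two marginals.

The condition on `φ` puts the eigenvalues of `Φ` inside the open unit disc, so `Φ^k → 0`. Hence `I -
Φ ⊗ Φ` is invertible, the Lyapunov equation has a unique and therefore symmetric solution, and
unrolling it shows positive definiteness (`arCov_posDef`).

The process lives on a product space carrying an initial vector and IID t-errors, and is defined by
recursion; the initial law enters through the measure only. The next error is independent of the
past, so conditional expectations are computed by freezing the past (`condExp_of_indep`). This gives
the Markov property and, the errors having mean zero and unit variance, the conditional moments. -/

/-! ### Powers of the companion matrix -/

section PowersTendToZero

open Filter Topology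

/-- In a complex Banach algebra, the powers of an element whose spectrum lies in the open unit disc
tend to zero. -/
theorem tendsto_norm_pow_zero_of_spectrum {A : Type*} [NormedRing A] [NormedAlgebra ℂ A]
    [CompleteSpace A] [Nontrivial A] (a : A) (ha : ∀ z ∈ spectrum ℂ a, ‖z‖ < 1) :
    Tendsto (fun k : ℕ => ‖a ^ k‖) atTop (𝓝 0) := by
  have h1 : spectralRadius ℂ a < (1 : NNReal) :=
    spectrum.spectralRadius_lt_of_forall_lt a fun z hz => by
      have := ha z hz
      exact_mod_cast this
  obtain ⟨r, hr1, hr2⟩ := ENNReal.lt_iff_exists_nnreal_btwn.1 h1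
  have hr2' : r < 1 := by exact_mod_cast hr2
  -- Gelfand's formula: with `r` strictly between the spectral radius and 1, eventually `‖a ^ k‖ ≤ r
  -- ^ k`.
  have h2 := (spectrum.pow_nnnorm_pow_one_div_tendsto_nhds_spectralRadius a).eventually_lt_const hr1
  have h3 : ∀ᶠ k : ℕ in atTop, ‖a ^ k‖ ≤ (r : ℝ) ^ k := by
    filter_upwards [h2, eventually_gt_atTop 0] with k hk hk0
    have h4 : ((‖a ^ k‖₊ : ENNReal) ^ (1 / (k : ℝ))) ^ (k : ℝ) ≤ (r : ENNReal) ^ (k : ℝ) :=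
      ENNReal.rpow_le_rpow hk.le (by positivity)
    rw [← ENNReal.rpow_mul, one_div_mul_cancel (by positivity), ENNReal.rpow_one,
      ENNReal.rpow_natCast] at h4
    exact_mod_cast h4
  exact squeeze_zero' (Eventually.of_forall fun _ => norm_nonneg _) h3
    (tendsto_pow_atTop_nhds_zero_of_lt_one r.2 (by exact_mod_cast hr2'))

/-- The powers of a complex matrix whose eigenvalues lie in the open unit disc tend to zero. -/
theorem Matrix.tendsto_pow_apply_zero {n : Type*} [Fintype n] [DecidableEq n] [Nonempty n]
    (A : Matrix n n ℂ) (hA : ∀ (z : ℂ) (v : n → ℂ), v ≠ 0 → A *ᵥ v = z • v → ‖z‖ < 1) (i j : n) :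
    Tendsto (fun k : ℕ => (A ^ k) i j) atTop (𝓝 0) := by
  -- Any submultiplicative norm would do; this one dominates each entry by a row sum.
  let _ := Matrix.linftyOpNormedRing (n := n) (α := ℂ)
  let _ := Matrix.linftyOpNormedAlgebra (n := n) (R := ℂ) (α := ℂ)
  have h := tendsto_norm_pow_zero_of_spectrum A fun z hz => by
    rw [← Matrix.spectrum_toLin' A, ← Module.End.hasEigenvalue_iff_mem_spectrum] at hz
    obtain ⟨v, hv⟩ := hz.exists_hasEigenvector
    exact hA z v hv.2 (by simpa using hv.apply_eq_smul)
  refine squeeze_zero_norm (fun k => ?_) h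
  have h1 : ‖(A ^ k) i j‖₊ ≤ ‖A ^ k‖₊ := by
    rw [Matrix.linfty_opNNNorm_def]
    exact (Finset.single_le_sum (f := fun j => ‖(A ^ k) i j‖₊) (fun _ _ => zero_le)
      (Finset.mem_univ j)).trans
      (Finset.le_sup (f := fun i => ∑ j, ‖(A ^ k) i j‖₊) (Finset.mem_univ i))
  exact_mod_cast h1

theorem arCompanion_apply_zero {q : ℕ} (φ : Fin (q + 1) → ℝ) (j : Fin (q + 1)) :
    arCompanion φ 0 j = φ j := rfl

theorem arCompanion_apply_succ {q : ℕ} (φ : Fin (q + 1) → ℝ) (i : Fin q) (j : Fin (q + 1)) :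
    arCompanion φ i.succ j = if i.castSucc = j then 1 else 0 := by
  rw [arCompanion, Matrix.of_apply, if_neg (by simp)]
  simp only [Fin.val_succ, Nat.add_right_cancel_iff, Fin.ext_iff, Fin.val_castSucc]

/-- The shift rows force an eigenvector for `z ≠ 0` to be geometric, `v i = z⁻¹ ^ i * v 0`. The
first row then makes `z⁻¹` a root of the autoregressive polynomial, which is excluded when `‖z⁻¹‖ ≤
1`. -/
theorem norm_lt_one_of_arCompanion_eigenvector {q : ℕ} {φ : Fin (q + 1) → ℝ}
    (hφ : φ ∈ stationarityRegion (q + 1)) (z : ℂ) (v : Fin (q + 1) → ℂ) (hv : v ≠ 0)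
    (h : (arCompanion φ).map (algebraMap ℝ ℂ) *ᵥ v = z • v) : ‖z‖ < 1 := by
  by_contra! hz
  have hz0 : z ≠ 0 := by rintro rfl; simp at hz; linarith
  have h0 : ∑ j, (φ j : ℂ) * v j = z * v 0 := by
    simpa [Matrix.mulVec, dotProduct, arCompanion_apply_zero] using congrFun h 0
  have hs : ∀ i : Fin q, v i.castSucc = z * v i.succ := fun i => by
    simpa [Matrix.mulVec, dotProduct, arCompanion_apply_succ, apply_ite] using congrFun h i.succ
  have hpow : ∀ i : Fin (q + 1), v i = z⁻¹ ^ (i : ℕ) * v 0 := by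
    intro i
    induction i using Fin.induction with
    | zero => simp
    | succ i ih =>
      rw [Fin.val_succ, pow_succ, mul_comm _ z⁻¹, mul_assoc]
      rw [Fin.val_castSucc, hs i] at ih
      rw [← ih]; field_simp
  have hv0 : v 0 ≠ 0 := fun h0 => hv (funext fun i => by simp [hpow i, h0])
  refine hφ z⁻¹ (by rw [norm_inv]; exact inv_le_one_of_one_le₀ hz) ?_
  have h1 : z⁻¹ * ∑ j, (φ j : ℂ) * v j = v 0 := by rw [h0]; field_simp
  have h2 : z⁻¹ * ∑ j, (φ j : ℂ) * v j = (∑ i, (φ i : ℂ) * z⁻¹ ^ ((i : ℕ) + 1)) * v 0 := by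
    rw [Finset.mul_sum, Finset.sum_mul]
    exact Finset.sum_congr rfl fun i _ => by rw [hpow i]; ring
  rw [h1] at h2
  have h3 : (1 - ∑ i, (φ i : ℂ) * z⁻¹ ^ ((i : ℕ) + 1)) * v 0 = 0 := by
    rw [sub_mul, ← h2, one_mul, sub_self]
  exact (mul_eq_zero.1 h3).resolve_right hv0

theorem tendsto_arCompanion_pow {q : ℕ} {φ : Fin (q + 1) → ℝ}
    (hφ : φ ∈ stationarityRegion (q + 1)) :
    Tendsto (fun k : ℕ => arCompanion φ ^ k) atTop (𝓝 0) := by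
  refine tendsto_pi_nhds.2 fun i => tendsto_pi_nhds.2 fun j => ?_
  have h := Matrix.tendsto_pow_apply_zero ((arCompanion φ).map (algebraMap ℝ ℂ))
    (norm_lt_one_of_arCompanion_eigenvector hφ) i j
  have h' : ∀ k : ℕ, ((arCompanion φ).map (algebraMap ℝ ℂ) ^ k) i j
      = (((arCompanion φ ^ k) i j : ℝ) : ℂ) := fun k => by
    rw [← Matrix.map_pow]; rfl
  simp_rw [h'] at h
  have h2 := (Complex.continuous_re.tendsto 0).comp h
  simpa [Function.comp_def] using h2

end PowersTendToZero

/-! ### The Lyapunov equation -/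

section Lyapunov

open Filter Topology

variable {n : Type*} [Fintype n] [DecidableEq n]

/-- Iterating the equation gives `D = A ^ k * D * (A ^ k)ᵀ`, which tends to zero. This is the
uniqueness behind both invertibility and symmetry below. -/
theorem Matrix.eq_zero_of_stein_homogeneous {A D : Matrix n n ℝ}
    (hA : Tendsto (fun k : ℕ => A ^ k) atTop (𝓝 0)) (hD : D = A * D * Aᵀ) : D = 0 := by
  have h : ∀ k : ℕ, D = A ^ k * D * (A ^ k)ᵀ := by
    intro k
    induction k with
    | zero => simp
    | succ k ih =>
      conv_lhs => rw [ih, hD]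
      simp only [pow_succ, Matrix.transpose_mul, Matrix.mul_assoc]
  have h1 : Tendsto (fun k : ℕ => A ^ k * D * (A ^ k)ᵀ) atTop
      (𝓝 ((0 : Matrix n n ℝ) * D * (0 : Matrix n n ℝ)ᵀ)) :=
    (hA.mul tendsto_const_nhds).mul ((continuous_id.matrix_transpose.tendsto 0).comp hA)
  simp only [← h] at h1
  simpa using tendsto_nhds_unique tendsto_const_nhds h1

/-- If the powers of `A` tend to zero, then `I - A ⊗ A` is invertible. -/
theorem Matrix.isUnit_one_sub_kronecker {A : Matrix n n ℝ}
    (hA : Tendsto (fun k : ℕ => A ^ k) atTop (𝓝 0)) : IsUnit (1 - A ⊗ₖ A) := by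
  rw [← Matrix.mulVec_injective_iff_isUnit]
  refine (injective_iff_map_eq_zero (Matrix.mulVecLin (1 - A ⊗ₖ A))).2 fun v hv => ?_
  obtain ⟨D, rfl⟩ := Matrix.vec_bijective.2 v
  rw [Matrix.mulVecLin_apply, Matrix.sub_mulVec, Matrix.one_mulVec, Matrix.kronecker_mulVec_vec,
    sub_eq_zero, Matrix.vec_inj] at hv
  rw [Matrix.eq_zero_of_stein_homogeneous hA hv, Matrix.vec_zero]

end Lyapunov

/-- The vectorized definition, undone: the covariance of `Φ X + noise` when `X` has covariance
`Γ_p`. Later facts about `arCov` rest on this equation instead of the inverse. -/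
theorem arCov_eq {q : ℕ} {φ : Fin (q + 1) → ℝ} (hφ : φ ∈ stationarityRegion (q + 1)) (σ : ℝ) :
    arCov φ σ = arCompanion φ * arCov φ σ * (arCompanion φ)ᵀ + Matrix.single 0 0 (σ ^ 2) := by
  have h := Matrix.isUnit_one_sub_kronecker (tendsto_arCompanion_pow hφ)
  have h1 : (arCov φ σ).vec = (1 - arCompanion φ ⊗ₖ arCompanion φ)⁻¹ *ᵥ
      (Matrix.single 0 0 (σ ^ 2)).vec := by
    ext ⟨i, j⟩
    simp only [Matrix.vec, arCov, Matrix.of_apply]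
    congr 2
    ext ⟨k, l⟩
    simp only [Matrix.vec, Matrix.single, Matrix.of_apply, Fin.ext_iff, Fin.val_zero,
      @eq_comm ℕ 0]
    -- `Matrix.vec` indexes by (column, row); the swap is harmless as the source term sits in the
    -- corner.
    exact if_congr and_comm rfl rfl
  have h2 : (1 - arCompanion φ ⊗ₖ arCompanion φ) *ᵥ (arCov φ σ).vec =
      (Matrix.single 0 0 (σ ^ 2)).vec := by
    rw [h1, Matrix.mulVec_mulVec, Matrix.mul_nonsing_inv _ ((Matrix.isUnit_iff_isUnit_det _).1 h),
      Matrix.one_mulVec]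
  rw [Matrix.sub_mulVec, Matrix.one_mulVec, Matrix.kronecker_mulVec_vec, sub_eq_iff_eq_add,
    ← Matrix.vec_add, Matrix.vec_inj] at h2
  exact h2.trans (add_comm _ _)

/-- The transpose solves the same Lyapunov equation, so the difference solves the homogeneous one.
-/
theorem arCov_transpose {q : ℕ} {φ : Fin (q + 1) → ℝ} (hφ : φ ∈ stationarityRegion (q + 1))
    (σ : ℝ) : (arCov φ σ)ᵀ = arCov φ σ := by
  rw [← sub_eq_zero]
  refine Matrix.eq_zero_of_stein_homogeneous (tendsto_arCompanion_pow hφ) ?_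
  have h := arCov_eq hφ σ
  have h2 := congrArg Matrix.transpose h
  rw [Matrix.transpose_add, Matrix.transpose_mul, Matrix.transpose_mul, Matrix.transpose_transpose,
    Matrix.transpose_single, ← Matrix.mul_assoc] at h2
  rw [mul_sub, sub_mul]
  exact (congrArg₂ (· - ·) h2 h).trans (add_sub_add_right_eq_sub _ _ _)

/-- The Lyapunov equation unrolled `k` times under the quadratic form; each step splits off `σ²`
times one squared coordinate. -/
theorem vecMul_arCompanion_arCov {q : ℕ} {φ : Fin (q + 1) → ℝ}
    (hφ : φ ∈ stationarityRegion (q + 1)) (σ : ℝ) (x : Fin (q + 1) → ℝ) (k : ℕ) :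
    x ⬝ᵥ (arCov φ σ *ᵥ x) = σ ^ 2 * ∑ j ∈ Finset.range k, (x ᵥ* arCompanion φ ^ j) 0 ^ 2 +
      (x ᵥ* arCompanion φ ^ k) ⬝ᵥ (arCov φ σ *ᵥ (x ᵥ* arCompanion φ ^ k)) := by
  induction k with
  | zero => simp
  | succ k ih =>
    rw [ih, Finset.sum_range_succ, mul_add, add_assoc]
    congr 1
    generalize hy : x ᵥ* arCompanion φ ^ k = y
    rw [pow_succ (arCompanion φ), ← Matrix.vecMul_vecMul, hy]
    have h := congrArg (fun M => y ⬝ᵥ (M *ᵥ y)) (arCov_eq hφ σ)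
    simp only [Matrix.add_mulVec, dotProduct_add] at h
    rw [h, add_comm]
    congr 1
    · rw [Matrix.single_mulVec_eq, dotProduct_smul, dotProduct_single_one, smul_eq_mul]
      ring
    · rw [← Matrix.mulVec_mulVec, Matrix.mulVec_transpose, ← Matrix.mulVec_mulVec,
        Matrix.dotProduct_mulVec]

/-- The quadratic form of `Γ_p` dominates the partial sums of its series representation. -/
theorem sum_sq_le_arCov {q : ℕ} {φ : Fin (q + 1) → ℝ} (hφ : φ ∈ stationarityRegion (q + 1))
    (σ : ℝ) (x : Fin (q + 1) → ℝ) (k : ℕ) :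
    σ ^ 2 * ∑ j ∈ Finset.range k, (x ᵥ* arCompanion φ ^ j) 0 ^ 2 ≤ x ⬝ᵥ (arCov φ σ *ᵥ x) := by
  have h : Continuous fun M : Matrix (Fin (q + 1)) (Fin (q + 1)) ℝ =>
      (x ᵥ* M) ⬝ᵥ (arCov φ σ *ᵥ (x ᵥ* M)) := by fun_prop
  -- The remainder cannot simply be dropped, since nonnegativity of the form is not yet known; it is
  -- sent to zero along `N → ∞` instead.
  have h1 := (h.tendsto 0).comp (tendsto_arCompanion_pow hφ)
  simp only [Matrix.vecMul_zero, zero_dotProduct] at h1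
  have h2 := h1.const_add (σ ^ 2 * ∑ j ∈ Finset.range k, (x ᵥ* arCompanion φ ^ j) 0 ^ 2)
  rw [add_zero] at h2
  refine le_of_tendsto h2 ?_
  filter_upwards [Filter.eventually_ge_atTop k] with N hN
  rw [vecMul_arCompanion_arCov hφ σ x N]
  simp only [Function.comp_apply]
  gcongr

/-- The first columns of `Φ^0, …, Φ^q` form a unitriangular matrix: the entries above row `k`
involve `φ` but are not needed. This is controllability of `(Φ, e₁)`. -/
theorem arCompanion_pow_apply_zero {q : ℕ} (φ : Fin (q + 1) → ℝ) (k : ℕ) :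
    ∀ i : Fin (q + 1), k ≤ (i : ℕ) → (arCompanion φ ^ k) i 0 = if (i : ℕ) = k then 1 else 0 := by
  induction k with
  | zero =>
    intro i _
    rw [pow_zero, Matrix.one_apply]
    exact if_congr Fin.ext_iff rfl rfl
  | succ k ih =>
    intro i hi
    obtain ⟨j, rfl⟩ := Fin.exists_succ_eq.2 (show i ≠ 0 by rintro rfl; simp at hi)
    have hj := ih j.castSucc (by simpa using hi)
    simp only [pow_succ', Matrix.mul_apply, arCompanion_apply_succ, ite_mul, one_mul, zero_mul,
      Finset.sum_ite_eq, Finset.mem_univ, if_true, hj]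
    simp

/-- If the form were nonpositive at `x`, every term of the series, hence every `(x Φ^k)_0`, would
vanish; unitriangularity then kills the coordinates of `x` one after another. -/
theorem arCov_posDef {q : ℕ} {φ : Fin (q + 1) → ℝ} (hφ : φ ∈ stationarityRegion (q + 1))
    {σ : ℝ} (hσ : 0 < σ) : (arCov φ σ).PosDef := by
  refine Matrix.PosDef.of_dotProduct_mulVec_pos ?_ fun x hx => ?_
  · rw [Matrix.IsHermitian, Matrix.conjTranspose_eq_transpose_of_trivial, arCov_transpose hφ]
  rw [star_trivial]
  by_contra! hneg
  have h0 : ∀ k : ℕ, (x ᵥ* arCompanion φ ^ k) 0 = 0 := by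
    intro k
    have h1 := (sum_sq_le_arCov hφ σ x (k + 1)).trans hneg
    have h2 : ∑ j ∈ Finset.range (k + 1), (x ᵥ* arCompanion φ ^ j) 0 ^ 2 ≤ 0 :=
      nonpos_of_mul_nonpos_right h1 (by positivity)
    have h3 := Finset.single_le_sum (f := fun j => (x ᵥ* arCompanion φ ^ j) 0 ^ 2)
      (fun _ _ => sq_nonneg _) (Finset.self_mem_range_succ k)
    exact pow_eq_zero_iff two_ne_zero |>.1 (le_antisymm (h3.trans h2) (sq_nonneg _))
  refine hx (funext fun i => ?_)
  induction i using WellFoundedLT.induction with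
  | ind i ih =>
    have h := h0 i
    rw [Matrix.vecMul, dotProduct, Finset.sum_eq_single i] at h
    · simpa [arCompanion_pow_apply_zero] using h
    · intro j _ hj
      rcases lt_or_gt_of_ne hj with hj | hj
      · simp [ih j hj]
      · rw [arCompanion_pow_apply_zero φ _ j hj.le, if_neg (by simpa [Fin.ext_iff] using hj.ne'),
          mul_zero]
    · simp

/-! ### Block form of covariance matrices -/

section SchurCov

variable {d : ℕ}

/-- The covariance matrix of `(b ⬝ᵥ X + e, X)`, where `X` has covariance matrix `S` and `e` is
uncorrelated with `X` and has variance `s`. -/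
def schurCov (s : ℝ) (b : Fin d → ℝ) (S : Matrix (Fin d) (Fin d) ℝ) :
    Matrix (Fin (d + 1)) (Fin (d + 1)) ℝ :=
  Matrix.of (Matrix.vecCons (Matrix.vecCons (s + b ⬝ᵥ (S *ᵥ b)) (S *ᵥ b))
    fun i => Matrix.vecCons ((S *ᵥ b) i) (S i))

theorem schurCov_mulVec_cons (s : ℝ) (b : Fin d → ℝ) {S : Matrix (Fin d) (Fin d) ℝ} (hS : Sᵀ = S)
    (a : ℝ) (x : Fin d → ℝ) :
    schurCov s b S *ᵥ Matrix.vecCons a x =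
      Matrix.vecCons (s * a + b ⬝ᵥ (S *ᵥ (a • b + x))) (S *ᵥ (a • b + x)) := by
  have h : (S *ᵥ b) ⬝ᵥ x = b ⬝ᵥ (S *ᵥ x) := by
    rw [Matrix.dotProduct_mulVec, ← Matrix.mulVec_transpose, hS]
  ext i
  refine Fin.cases ?_ (fun i => ?_) i
  · simp only [schurCov, Matrix.mulVec, Matrix.of_apply, Matrix.cons_val_zero,
      Matrix.cons_dotProduct_cons]
    change (s + b ⬝ᵥ (S *ᵥ b)) * a + (S *ᵥ b) ⬝ᵥ x = s * a + b ⬝ᵥ (S *ᵥ (a • b + x))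
    rw [h, Matrix.mulVec_add, Matrix.mulVec_smul, dotProduct_add, dotProduct_smul, smul_eq_mul]
    ring
  · rw [Matrix.cons_val_succ, Matrix.mulVec_add, Matrix.mulVec_smul]
    simp only [schurCov, Matrix.mulVec, Matrix.of_apply, Matrix.cons_val_succ,
      Matrix.cons_dotProduct_cons, Pi.add_apply, Pi.smul_apply, smul_eq_mul]
    ring

theorem schurCov_transpose (s : ℝ) (b : Fin d → ℝ) {S : Matrix (Fin d) (Fin d) ℝ} (hS : Sᵀ = S) :
    (schurCov s b S)ᵀ = schurCov s b S := by
  ext i j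
  refine Fin.cases ?_ (fun i => ?_) i <;> refine Fin.cases ?_ (fun j => ?_) j <;>
    simp [schurCov]
  exact congrFun (congrFun hS i) j

/-- This is the variance of `a (b ⬝ᵥ X + e) + x ⬝ᵥ X = a e + (a b + x) ⬝ᵥ X`, whose two terms are
uncorrelated. -/
theorem schurCov_quadForm (s : ℝ) (b : Fin d → ℝ) {S : Matrix (Fin d) (Fin d) ℝ} (hS : Sᵀ = S)
    (a : ℝ) (x : Fin d → ℝ) :
    Matrix.vecCons a x ⬝ᵥ (schurCov s b S *ᵥ Matrix.vecCons a x) =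
      s * a ^ 2 + (a • b + x) ⬝ᵥ (S *ᵥ (a • b + x)) := by
  rw [schurCov_mulVec_cons s b hS, Matrix.cons_dotProduct_cons, add_dotProduct, smul_dotProduct,
    smul_eq_mul]
  ring

theorem schurCov_posDef {s : ℝ} (hs : 0 < s) (b : Fin d → ℝ) {S : Matrix (Fin d) (Fin d) ℝ}
    (hS : S.PosDef) : (schurCov s b S).PosDef := by
  have hSt : Sᵀ = S := by simpa [Matrix.IsHermitian] using hS.isHermitian
  refine Matrix.PosDef.of_dotProduct_mulVec_pos ?_ fun y hy => ?_
  · rw [Matrix.IsHermitian, Matrix.conjTranspose_eq_transpose_of_trivial, schurCov_transpose s b hSt]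
  rw [star_trivial, ← Fin.cons_self_tail y]
  set a := y 0
  set x := Fin.tail y
  change 0 < Matrix.vecCons a x ⬝ᵥ (schurCov s b S *ᵥ Matrix.vecCons a x)
  rw [schurCov_quadForm s b hSt]
  have h1 : 0 ≤ (a • b + x) ⬝ᵥ (S *ᵥ (a • b + x)) := by
    simpa using hS.posSemidef.dotProduct_mulVec_nonneg (a • b + x)
  rcases eq_or_ne a 0 with ha | ha
  · have hx : x ≠ 0 := by
      rintro hx
      refine hy ?_
      rw [← Fin.cons_self_tail y]
      change Matrix.vecCons a x = 0
      rw [ha, hx]; simp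
    simpa [ha] using hS.dotProduct_mulVec_pos hx
  · positivity

/-- The regression residual `a - b ⬝ᵥ x` and `x` are uncorrelated coordinates with covariances `s`
and `S`, so the inverse form splits. -/
theorem schurCov_inv_quadForm {s : ℝ} (hs : 0 < s) (b : Fin d → ℝ) {S : Matrix (Fin d) (Fin d) ℝ}
    (hS : S.PosDef) (a : ℝ) (x : Fin d → ℝ) :
    Matrix.vecCons a x ⬝ᵥ ((schurCov s b S)⁻¹ *ᵥ Matrix.vecCons a x) =
      (a - b ⬝ᵥ x) ^ 2 / s + x ⬝ᵥ (S⁻¹ *ᵥ x) := by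
  have hSt : Sᵀ = S := by simpa [Matrix.IsHermitian] using hS.isHermitian
  have hSu : IsUnit S.det := (Matrix.isUnit_iff_isUnit_det _).1 hS.isUnit
  have hu : IsUnit (schurCov s b S).det :=
    (Matrix.isUnit_iff_isUnit_det _).1 (schurCov_posDef hs b hS).isUnit
  set k := (a - b ⬝ᵥ x) / s with hk
  -- Solving the linear system: the lower rows force the tail to be `S⁻¹ x - k b`, and the top row
  -- becomes `s k + b ⬝ᵥ x = a`.
  have h : schurCov s b S *ᵥ Matrix.vecCons k (S⁻¹ *ᵥ x - k • b) = Matrix.vecCons a x := by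
    rw [schurCov_mulVec_cons s b hSt, add_sub_cancel, Matrix.mulVec_mulVec,
      Matrix.mul_nonsing_inv _ hSu, Matrix.one_mulVec, hk, mul_div_cancel₀ _ hs.ne',
      sub_add_cancel]
  have h2 : (schurCov s b S)⁻¹ *ᵥ Matrix.vecCons a x = Matrix.vecCons k (S⁻¹ *ᵥ x - k • b) := by
    rw [← h, Matrix.mulVec_mulVec, Matrix.nonsing_inv_mul _ hu, Matrix.one_mulVec]
  rw [h2, Matrix.cons_dotProduct_cons, dotProduct_sub, dotProduct_smul, smul_eq_mul,
    dotProduct_comm x b, hk]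
  field_simp
  ring

/-- Block factorization into `[1 b; 0 I]` and `[s 0; S b S]`. -/
theorem schurCov_det (s : ℝ) (b : Fin d → ℝ) {S : Matrix (Fin d) (Fin d) ℝ} (hS : Sᵀ = S) :
    (schurCov s b S).det = s * S.det := by
  have h : schurCov s b S =
      Matrix.of (Matrix.vecCons (Matrix.vecCons 1 b) fun i => Matrix.vecCons 0 (fun j =>
        (1 : Matrix (Fin d) (Fin d) ℝ) i j)) *
      Matrix.of (Matrix.vecCons (Matrix.vecCons s 0) fun i => Matrix.vecCons ((S *ᵥ b) i) (S i)) := by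
    have hb : S *ᵥ b = b ᵥ* S := by rw [← Matrix.mulVec_transpose, hS]
    ext i j
    refine Fin.cases ?_ (fun i => ?_) i <;> refine Fin.cases ?_ (fun j => ?_) j <;>
      simp [schurCov, Matrix.mul_apply, Fin.sum_univ_succ, Matrix.one_apply]
    · rfl
    · rw [hb]; rfl
  rw [h, Matrix.det_mul, Matrix.det_succ_column_zero, Matrix.det_succ_row_zero,
    Fin.sum_univ_succ, Fin.sum_univ_succ]
  have h1 : (Matrix.submatrix (Matrix.of (Matrix.vecCons (Matrix.vecCons 1 b) fun i =>
      Matrix.vecCons 0 (fun j => (1 : Matrix (Fin d) (Fin d) ℝ) i j))) (Fin.succAbove 0) Fin.succ)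
      = 1 := by ext i j; simp
  have h2 : (Matrix.submatrix (Matrix.of (Matrix.vecCons (Matrix.vecCons s 0) fun i =>
      Matrix.vecCons ((S *ᵥ b) i) (S i))) Fin.succ (Fin.succAbove 0)) = S := by ext i j; simp
  rw [h1, h2]
  simp

/-- Regression of the first coordinate on the others, with the Schur complement as residual
variance; it is positive because it is the value of the form at `(1, -b)`. It lets an induction on
the dimension peel off one coordinate. -/
theorem exists_eq_schurCov {T : Matrix (Fin (d + 1)) (Fin (d + 1)) ℝ} (hT : T.PosDef) :
    ∃ (s : ℝ) (b : Fin d → ℝ) (S : Matrix (Fin d) (Fin d) ℝ),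
      0 < s ∧ S.PosDef ∧ T = schurCov s b S := by
  have hTt : Tᵀ = T := by simpa [Matrix.IsHermitian] using hT.isHermitian
  set S := T.submatrix Fin.succ Fin.succ with hSdef
  have hS : S.PosDef := hT.submatrix (Fin.succ_injective d)
  have hSu : IsUnit S.det := (Matrix.isUnit_iff_isUnit_det _).1 hS.isUnit
  have hSt : Sᵀ = S := by simpa [Matrix.IsHermitian] using hS.isHermitian
  set c : Fin d → ℝ := fun i => T i.succ 0 with hc
  set b := S⁻¹ *ᵥ c with hb
  have hSb : S *ᵥ b = c := by
    rw [hb, Matrix.mulVec_mulVec, Matrix.mul_nonsing_inv _ hSu, Matrix.one_mulVec]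
  have hTs : T = schurCov (T 0 0 - b ⬝ᵥ (S *ᵥ b)) b S := by
    ext i j
    refine Fin.cases ?_ (fun i => ?_) i <;> refine Fin.cases ?_ (fun j => ?_) j
    · simp [schurCov]
    · simp only [schurCov, hSb, Matrix.of_apply, Matrix.cons_val_zero, Matrix.cons_val_succ]
      exact (congrFun (congrFun hTt 0) j.succ).symm
    · simp [schurCov, hSb, hc]
    · simp [schurCov, hSdef]
  refine ⟨_, b, S, ?_, hS, hTs⟩
  have h := hT.dotProduct_mulVec_pos (x := Matrix.vecCons 1 (-b)) (fun h => by
    simpa using congrFun h 0)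
  rw [star_trivial, hTs, schurCov_quadForm _ _ hSt] at h
  simpa using h

end SchurCov

theorem arCovSucc_eq_schurCov {p : ℕ} (φ : Fin p → ℝ) (σ : ℝ) :
    arCovSucc φ σ = schurCov (σ ^ 2) φ (arCov φ σ) := rfl

theorem arCovSucc_posDef {q : ℕ} {φ : Fin (q + 1) → ℝ} (hφ : φ ∈ stationarityRegion (q + 1))
    {σ : ℝ} (hσ : 0 < σ) : (arCovSucc φ σ).PosDef :=
  schurCov_posDef (by positivity) φ (arCov_posDef hφ hσ)

/-! ### Stationarity of the autocovariances -/

theorem arCovSucc_succ_succ {p : ℕ} (φ : Fin p → ℝ) (σ : ℝ) (i j : Fin p) :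
    arCovSucc φ σ i.succ j.succ = arCov φ σ i j := rfl

/-- The Lyapunov equation read entry by entry. Together with `arCovSucc_succ_succ` it says that both
diagonal blocks of `Γ_{p+1}` equal `Γ_p`, so `Γ_{p+1}` is Toeplitz. -/
theorem arCovSucc_castSucc_castSucc {q : ℕ} {φ : Fin (q + 1) → ℝ}
    (hφ : φ ∈ stationarityRegion (q + 1)) (σ : ℝ) (i j : Fin (q + 1)) :
    arCovSucc φ σ i.castSucc j.castSucc = arCov φ σ i j := by
  have h := arCov_eq hφ σ
  have hs : ∀ (i : Fin q) (A : Matrix (Fin (q + 1)) (Fin (q + 1)) ℝ) (j : Fin (q + 1)),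
      (arCompanion φ * A) i.succ j = A i.castSucc j := fun i A j => by
    simp [Matrix.mul_apply, arCompanion_apply_succ]
  have hz : ∀ (A : Matrix (Fin (q + 1)) (Fin (q + 1)) ℝ) (j : Fin (q + 1)),
      (arCompanion φ * A) 0 j = (φ ᵥ* A) j := fun A j => rfl
  have hs' : ∀ (i : Fin q) (A : Matrix (Fin (q + 1)) (Fin (q + 1)) ℝ) (j : Fin (q + 1)),
      (A * (arCompanion φ)ᵀ) j i.succ = A j i.castSucc := fun i A j => by
    simp [Matrix.mul_apply, arCompanion_apply_succ]
  have hz' : ∀ (A : Matrix (Fin (q + 1)) (Fin (q + 1)) ℝ) (j : Fin (q + 1)),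
      (A * (arCompanion φ)ᵀ) j 0 = (A *ᵥ φ) j := fun A j => rfl
  have hb : arCov φ σ *ᵥ φ = φ ᵥ* arCov φ σ := by
    rw [← Matrix.mulVec_transpose, arCov_transpose hφ]
  conv_rhs => rw [h]
  rw [Matrix.add_apply, Matrix.mul_assoc]
  refine Fin.cases ?_ (fun i => ?_) i <;> refine Fin.cases ?_ (fun j => ?_) j
  · rw [← Matrix.mul_assoc, hz', ← Matrix.mulVec_mulVec, Matrix.single_apply_same]
    change σ ^ 2 + φ ⬝ᵥ (arCov φ σ *ᵥ φ) = φ ⬝ᵥ (arCov φ σ *ᵥ φ) + σ ^ 2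
    ring
  · rw [← Matrix.mul_assoc, hs', hz, ← hb, Matrix.single_apply_of_ne (h := by simp [Fin.ext_iff]),
      add_zero]
    rfl
  · rw [hs, hz', Matrix.single_apply_of_ne (h := by simp [Fin.ext_iff]), add_zero]
    rfl
  · rw [hs, hs', Matrix.single_apply_of_ne (h := by simp [Fin.ext_iff]), add_zero]
    rfl

/-- A symmetric Toeplitz matrix is invariant under reversal of the index set. -/
theorem Matrix.rev_rev_of_toeplitz {n : ℕ} {A : Matrix (Fin (n + 1)) (Fin (n + 1)) ℝ}
    (hA : Aᵀ = A) (h : ∀ i j : Fin n, A i.succ j.succ = A i.castSucc j.castSucc)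
    (i j : Fin (n + 1)) : A i.rev j.rev = A i j := by
  have hsymm : ∀ i j, A j i = A i j := fun i j => congrFun (congrFun hA i) j
  have hshift : ∀ (k : ℕ) (i j i' j' : Fin (n + 1)), (i : ℕ) + k = i' → (j : ℕ) + k = j' →
      A i' j' = A i j := by
    intro k
    induction k with
    | zero =>
      intro i j i' j' hi hj
      rw [Fin.ext (hi : (i : ℕ) = i'), Fin.ext (hj : (j : ℕ) = j')]
    | succ k ih =>
      intro i j i' j' hi hj
      have hin : (i : ℕ) < n := by omega
      have hjn : (j : ℕ) < n := by omega
      have h1 := h ⟨i, hin⟩ ⟨j, hjn⟩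
      rw [ih (Fin.succ ⟨i, hin⟩) (Fin.succ ⟨j, hjn⟩) i' j' (by simp; omega) (by simp; omega), h1]
      rfl
  -- After transposition the indices are `(n - j, n - i)`, a shift of `(i, j)` along its diagonal by
  -- `n - i - j`, whose sign decides the direction.
  rw [hsymm]
  rcases le_total ((i : ℕ) + j) n with hij | hij
  · exact hshift (n - (i + j)) i j j.rev i.rev (by simp [Fin.val_rev]; omega)
      (by simp [Fin.val_rev]; omega)
  · exact (hshift (i + j - n) j.rev i.rev i j (by simp [Fin.val_rev]; omega)
      (by simp [Fin.val_rev]; omega)).symm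

theorem arCovSucc_rev {q : ℕ} {φ : Fin (q + 1) → ℝ}
    (hφ : φ ∈ stationarityRegion (q + 1)) (σ : ℝ) (i j : Fin (q + 2)) :
    arCovSucc φ σ i.rev j.rev = arCovSucc φ σ i j :=
  Matrix.rev_rev_of_toeplitz (schurCov_transpose _ _ (arCov_transpose hφ σ))
    (fun i j => (arCovSucc_castSucc_castSucc hφ σ i j).symm) i j

theorem arCov_rev {q : ℕ} {φ : Fin (q + 1) → ℝ}
    (hφ : φ ∈ stationarityRegion (q + 1)) (σ : ℝ) (i j : Fin (q + 1)) :
    arCov φ σ i.rev j.rev = arCov φ σ i j := by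
  rw [← arCovSucc_succ_succ, ← Fin.rev_castSucc, ← Fin.rev_castSucc, arCovSucc_rev hφ,
    arCovSucc_castSucc_castSucc hφ]

theorem one_sub_sum_ne_zero {p : ℕ} {φ : Fin p → ℝ} (hφ : φ ∈ stationarityRegion p) :
    1 - ∑ i, φ i ≠ 0 := by
  have h := hφ 1 (by simp)
  simp only [one_pow, mul_one] at h
  exact_mod_cast h

/-- Since `φ₀ = (1 - ∑ φ_i) μ`, the mean function takes the centred regression form that the density
factorization produces. -/
theorem condMeanFun_eq {p : ℕ} (φ₀ : ℝ) {φ : Fin p → ℝ} (hφ : φ ∈ stationarityRegion p)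
    (x : Fin p → ℝ) :
    condMeanFun φ₀ φ x = arMean φ₀ φ + φ ⬝ᵥ (x - fun _ => arMean φ₀ φ) := by
  have h : φ ⬝ᵥ (fun _ => arMean φ₀ φ) = (∑ i, φ i) * arMean φ₀ φ := by
    rw [dotProduct, Finset.sum_mul]
  rw [condMeanFun, dotProduct_sub, h, arMean]
  have := one_sub_sum_ne_zero hφ
  field_simp
  ring

/-! ### The univariate t-distribution -/

section UnivariateIntegrals

open Set

theorem integrable_one_add_sq_rpow {a : ℝ} (ha : 1 / 2 < a) :
    Integrable fun x : ℝ => (1 + x ^ 2) ^ (-a) := by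
  have h := integrable_rpow_neg_one_add_norm_sq (E := ℝ) (μ := volume) (r := 2 * a)
    (by simp; linarith)
  simp only [Real.norm_eq_abs, sq_abs] at h
  convert h using 3
  ring

/-- Write `Γ(a) (1 + x²)^(-a)` as a Gamma integral in `s` and swap by Tonelli: the Gaussian integral
in `x` contributes `√(π / s)` and leaves `Γ(a - 1/2)`. -/
theorem integral_one_add_sq_rpow {a : ℝ} (ha : 1 / 2 < a) :
    ∫ x : ℝ, (1 + x ^ 2) ^ (-a) = √Real.pi * Real.Gamma (a - 1 / 2) / Real.Gamma a := by
  have ha0 : 0 < a := by linarith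
  have hG := Real.Gamma_pos_of_pos ha0
  have key : ∫⁻ x : ℝ, ENNReal.ofReal (Real.Gamma a * (1 + x ^ 2) ^ (-a)) =
      ENNReal.ofReal (√Real.pi * Real.Gamma (a - 1 / 2)) := by
    have h1 : ∀ x : ℝ, ENNReal.ofReal (Real.Gamma a * (1 + x ^ 2) ^ (-a)) =
        ∫⁻ s in Ioi (0 : ℝ), ENNReal.ofReal (s ^ (a - 1) * Real.exp (-((1 + x ^ 2) * s))) := by
      intro x
      have hx : (0 : ℝ) < 1 + x ^ 2 := by positivity
      have h := Real.integral_rpow_mul_exp_neg_mul_Ioi ha0 hx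
      rw [← ofReal_integral_eq_lintegral_ofReal, h, one_div, Real.inv_rpow hx.le,
        Real.rpow_neg hx.le, mul_comm]
      -- The Bochner integral of a non-integrable function is 0, so a nonzero value certifies
      -- integrability.
      · by_contra hn
        rw [integral_undef hn] at h
        have : 0 < (1 / (1 + x ^ 2)) ^ a * Real.Gamma a := by positivity
        exact this.ne h
      · filter_upwards [ae_restrict_mem measurableSet_Ioi] with s hs
        have : (0 : ℝ) < s := hs
        positivity
    have h2 : ∀ s ∈ Ioi (0 : ℝ),
        ∫⁻ x : ℝ, ENNReal.ofReal (s ^ (a - 1) * Real.exp (-((1 + x ^ 2) * s))) =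
        ENNReal.ofReal (√Real.pi * (s ^ (a - 1 / 2 - 1) * Real.exp (-(1 * s)))) := by
      intro s hs
      have hs : 0 < s := hs
      have h3 : ∀ x : ℝ, s ^ (a - 1) * Real.exp (-((1 + x ^ 2) * s)) =
          s ^ (a - 1) * Real.exp (-s) * Real.exp (-s * x ^ 2) := fun x => by
        rw [mul_assoc, ← Real.exp_add]; ring_nf
      simp_rw [h3]
      rw [← ofReal_integral_eq_lintegral_ofReal ((integrable_exp_neg_mul_sq hs).const_mul _)
        (Filter.Eventually.of_forall fun x => by positivity), integral_const_mul, integral_gaussian]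
      congr 1
      rw [show a - 1 / 2 - 1 = (a - 1) - 1 / 2 by ring, Real.rpow_sub hs (a - 1), ← Real.sqrt_eq_rpow,
        Real.sqrt_div Real.pi_pos.le, one_mul]
      ring
    simp_rw [h1]
    rw [lintegral_lintegral_swap (by fun_prop), setLIntegral_congr_fun measurableSet_Ioi h2]
    have h4 := Real.integral_rpow_mul_exp_neg_mul_Ioi (a := a - 1 / 2) (by linarith) one_pos
    rw [div_one, Real.one_rpow, one_mul] at h4
    rw [← ofReal_integral_eq_lintegral_ofReal, integral_const_mul, h4]
    · refine Integrable.const_mul ?_ _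
      by_contra hn
      rw [integral_undef hn] at h4
      exact (Real.Gamma_pos_of_pos (by linarith)).ne h4
    · filter_upwards [ae_restrict_mem measurableSet_Ioi] with s hs
      have : (0 : ℝ) < s := hs
      positivity
  rw [← ofReal_integral_eq_lintegral_ofReal ((integrable_one_add_sq_rpow ha).const_mul _)
    (Filter.Eventually.of_forall fun x => by positivity), integral_const_mul,
    ENNReal.ofReal_eq_ofReal_iff] at key
  · rw [eq_div_iff hG.ne', mul_comm, key]
  · exact mul_nonneg hG.le (integral_nonneg fun x => by positivity)
  · have := Real.Gamma_pos_of_pos (show 0 < a - 1 / 2 by linarith)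
    positivity

/-- Writing `x² = (1 + x²) - 1` reduces the second moment to the previous integral at `a - 1` and
`a`. -/
theorem sq_mul_one_add_sq_rpow (a x : ℝ) :
    x ^ 2 * (1 + x ^ 2) ^ (-a) = (1 + x ^ 2) ^ (-(a - 1)) - (1 + x ^ 2) ^ (-a) := by
  have hx : (0 : ℝ) < 1 + x ^ 2 := by positivity
  rw [show -(a - 1) = -a + 1 by ring, Real.rpow_add_one hx.ne']
  ring

theorem integral_sq_mul_one_add_sq_rpow {a : ℝ} (ha : 3 / 2 < a) :
    ∫ x : ℝ, x ^ 2 * (1 + x ^ 2) ^ (-a) =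
      √Real.pi * Real.Gamma (a - 3 / 2) / (2 * Real.Gamma a) := by
  simp_rw [sq_mul_one_add_sq_rpow]
  rw [integral_sub (integrable_one_add_sq_rpow (by linarith))
    (integrable_one_add_sq_rpow (by linarith)), integral_one_add_sq_rpow (by linarith),
    integral_one_add_sq_rpow (by linarith)]
  have h1 : Real.Gamma a = (a - 1) * Real.Gamma (a - 1) := by
    rw [← Real.Gamma_add_one (by linarith)]; ring_nf
  have h2 : Real.Gamma (a - 1 / 2) = (a - 3 / 2) * Real.Gamma (a - 3 / 2) := by
    rw [← Real.Gamma_add_one (by linarith)]; ring_nf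
  have h3 : Real.Gamma (a - 1) ≠ 0 := (Real.Gamma_pos_of_pos (by linarith)).ne'
  have h4 : a - 1 ≠ 0 := by linarith
  rw [h1, h2, show a - 1 - 1 / 2 = a - 3 / 2 by ring]
  field_simp
  ring

end UnivariateIntegrals

theorem studentT1PDF_nonneg (m : ℝ) {s2 ν : ℝ} (hs : 0 < s2) (hν : 2 < ν) (x : ℝ) :
    0 ≤ studentT1PDF m s2 ν x := by
  have h : 0 < ν - 2 := by linarith
  have h1 : 0 ≤ (x - m) * (s2⁻¹ * (x - m)) := by
    rw [show (x - m) * (s2⁻¹ * (x - m)) = s2⁻¹ * (x - m) ^ 2 by ring]; positivity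
  have := Real.Gamma_pos_of_pos (show 0 < (1 + ν) / 2 by linarith)
  have := Real.Gamma_pos_of_pos (show 0 < ν / 2 by linarith)
  have := Real.pi_pos
  unfold studentT1PDF
  positivity

@[fun_prop]
theorem measurable_studentT1PDF_uncurry {α : Type*} [MeasurableSpace α] {m s2 u : α → ℝ}
    (hm : Measurable m) (hs : Measurable s2) (hu : Measurable u) (ν : ℝ) :
    Measurable fun x => studentT1PDF (m x) (s2 x) ν (u x) := by
  unfold studentT1PDF
  fun_prop

theorem studentT1PDF_zero_one {ν : ℝ} (hν : 2 < ν) (x : ℝ) :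
    studentT1PDF 0 1 ν x = Real.Gamma ((1 + ν) / 2) / (√Real.pi * √(ν - 2) * Real.Gamma (ν / 2)) *
      (1 + ((√(ν - 2))⁻¹ * x) ^ 2) ^ (-((1 + ν) / 2)) := by
  rw [studentT1PDF, ← Real.sqrt_eq_rpow, Real.sqrt_mul Real.pi_pos.le, Real.one_rpow, mul_one,
    mul_pow, inv_pow, Real.sq_sqrt (by linarith)]
  congr 3
  ring

theorem integral_studentT1PDF_zero_one {ν : ℝ} (hν : 2 < ν) :
    ∫ x, studentT1PDF 0 1 ν x = 1 := by
  have h : 0 < ν - 2 := by linarith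
  have h1 := Real.Gamma_pos_of_pos (show 0 < (1 + ν) / 2 by linarith)
  have h2 := Real.Gamma_pos_of_pos (show 0 < ν / 2 by linarith)
  simp_rw [studentT1PDF_zero_one hν]
  rw [integral_const_mul, Measure.integral_comp_mul_left (fun y : ℝ => (1 + y ^ 2) ^ (-((1 + ν) / 2))),
    integral_one_add_sq_rpow (by linarith), inv_inv, abs_of_nonneg (Real.sqrt_nonneg _), smul_eq_mul,
    show (1 + ν) / 2 - 1 / 2 = ν / 2 by ring]
  have := Real.sqrt_pos.2 h
  have := Real.sqrt_pos.2 Real.pi_pos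
  field_simp

theorem integrable_studentT1PDF_zero_one {ν : ℝ} (hν : 2 < ν) :
    Integrable (studentT1PDF 0 1 ν) := by
  by_contra h
  simpa [integral_undef h] using integral_studentT1PDF_zero_one hν

theorem sq_mul_studentT1PDF_zero_one {ν : ℝ} (hν : 2 < ν) (x : ℝ) :
    x ^ 2 * studentT1PDF 0 1 ν x =
      (ν - 2) * (Real.Gamma ((1 + ν) / 2) / (√Real.pi * √(ν - 2) * Real.Gamma (ν / 2))) *
      (((√(ν - 2))⁻¹ * x) ^ 2 * (1 + ((√(ν - 2))⁻¹ * x) ^ 2) ^ (-((1 + ν) / 2))) := by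
  have h : 0 < ν - 2 := by linarith
  have h2 : (ν - 2) * ((√(ν - 2))⁻¹ * x) ^ 2 = x ^ 2 := by
    rw [mul_pow, inv_pow, Real.sq_sqrt h.le]; field_simp
  rw [studentT1PDF_zero_one hν, ← h2]
  ring

theorem integral_sq_mul_studentT1PDF_zero_one {ν : ℝ} (hν : 2 < ν) :
    ∫ x, x ^ 2 * studentT1PDF 0 1 ν x = 1 := by
  have h : 0 < ν - 2 := by linarith
  have h1 := Real.Gamma_pos_of_pos (show 0 < (1 + ν) / 2 by linarith)
  have h2 := Real.Gamma_pos_of_pos (show 0 < ν / 2 - 1 by linarith)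
  have h3 : Real.Gamma (ν / 2) = (ν / 2 - 1) * Real.Gamma (ν / 2 - 1) := by
    rw [← Real.Gamma_add_one (by linarith)]; ring_nf
  simp_rw [sq_mul_studentT1PDF_zero_one hν]
  rw [integral_const_mul,
    Measure.integral_comp_mul_left (fun y : ℝ => y ^ 2 * (1 + y ^ 2) ^ (-((1 + ν) / 2))),
    integral_sq_mul_one_add_sq_rpow (by linarith), inv_inv, abs_of_nonneg (Real.sqrt_nonneg _),
    smul_eq_mul, show (1 + ν) / 2 - 3 / 2 = ν / 2 - 1 by ring, h3]
  have := Real.sqrt_pos.2 h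
  have := Real.sqrt_pos.2 Real.pi_pos
  have : ν / 2 - 1 ≠ 0 := by linarith
  field_simp

theorem integrable_sq_mul_studentT1PDF_zero_one {ν : ℝ} (hν : 2 < ν) :
    Integrable fun x => x ^ 2 * studentT1PDF 0 1 ν x := by
  by_contra h
  simpa [integral_undef h] using integral_sq_mul_studentT1PDF_zero_one hν

theorem isProbabilityMeasure_studentT1_zero_one {ν : ℝ} (hν : 2 < ν) :
    IsProbabilityMeasure (studentT1 0 1 ν) := by
  refine ⟨?_⟩
  rw [studentT1, withDensity_apply _ MeasurableSet.univ, Measure.restrict_univ,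
    ← ofReal_integral_eq_lintegral_ofReal (integrable_studentT1PDF_zero_one hν)
    (Filter.Eventually.of_forall (studentT1PDF_nonneg 0 one_pos hν)),
    integral_studentT1PDF_zero_one hν, ENNReal.ofReal_one]

theorem integral_studentT1 (m : ℝ) {s2 ν : ℝ} (hs : 0 < s2) (hν : 2 < ν) (f : ℝ → ℝ) :
    ∫ x, f x ∂(studentT1 m s2 ν) = ∫ x, f x * studentT1PDF m s2 ν x := by
  rw [studentT1, integral_withDensity_eq_integral_toReal_smul (by fun_prop) (by simp)]
  refine integral_congr_ae (Filter.Eventually.of_forall fun x => ?_)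
  simp only [ENNReal.toReal_ofReal (studentT1PDF_nonneg m hs hν x), smul_eq_mul]
  ring

theorem memLp_id_studentT1_zero_one {ν : ℝ} (hν : 2 < ν) : MemLp id 2 (studentT1 0 1 ν) := by
  rw [memLp_two_iff_integrable_sq (by fun_prop), studentT1,
    integrable_withDensity_iff_integrable_smul' (by fun_prop) (by simp)]
  refine (integrable_sq_mul_studentT1PDF_zero_one hν).congr
    (Filter.Eventually.of_forall fun x => ?_)
  simp only [ENNReal.toReal_ofReal (studentT1PDF_nonneg 0 one_pos hν x), smul_eq_mul, id]
  ring

theorem integral_sq_studentT1_zero_one {ν : ℝ} (hν : 2 < ν) :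
    ∫ x, x ^ 2 ∂(studentT1 0 1 ν) = 1 := by
  rw [integral_studentT1 0 one_pos hν, integral_sq_mul_studentT1PDF_zero_one hν]

theorem integral_id_studentT1_zero_one {ν : ℝ} (hν : 2 < ν) :
    ∫ x, x ∂(studentT1 0 1 ν) = 0 := by
  rw [integral_studentT1 0 one_pos hν]
  have h := integral_neg_eq_self (fun x => x * studentT1PDF 0 1 ν x) volume
  have h2 : ∀ x, -x * studentT1PDF 0 1 ν (-x) = -(x * studentT1PDF 0 1 ν x) := fun x => by
    have : studentT1PDF 0 1 ν (-x) = studentT1PDF 0 1 ν x := by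
      unfold studentT1PDF
      congr 3
      ring
    rw [this]; ring
  simp_rw [h2] at h
  rw [integral_neg] at h
  linarith

/-- The t-distributions form a location-scale family. -/
theorem map_studentT1_zero_one (m : ℝ) {s2 : ℝ} (hs : 0 < s2) (ν : ℝ) :
    (studentT1 0 1 ν).map (fun e => m + √s2 * e) = studentT1 m s2 ν := by
  set r := √s2 with hr
  have hr0 : 0 < r := Real.sqrt_pos.2 hs
  have hr2 : r ^ 2 = s2 := Real.sq_sqrt hs.le
  have hpdf : ∀ e, studentT1PDF 0 1 ν e = r * studentT1PDF m s2 ν (m + r * e) := by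
    intro e
    unfold studentT1PDF
    have h1 : s2 ^ (-(1 / 2) : ℝ) = r⁻¹ := by
      rw [Real.rpow_neg hs.le, ← Real.sqrt_eq_rpow]
    have h2 : (m + r * e - m) * (s2⁻¹ * (m + r * e - m)) = (e - 0) * (1⁻¹ * (e - 0)) := by
      rw [← hr2]; field_simp; ring
    rw [h1, h2, Real.one_rpow]
    field_simp
  refine Measure.ext_of_lintegral _ fun f hf => ?_
  rw [lintegral_map hf (by fun_prop), studentT1, studentT1,
    lintegral_withDensity_eq_lintegral_mul _ (by fun_prop) (by fun_prop),
    lintegral_withDensity_eq_lintegral_mul _ (by fun_prop) (by fun_prop)]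
  simp only [Pi.mul_apply, hpdf]
  set G : ℝ → ENNReal := fun x => ENNReal.ofReal (r * studentT1PDF m s2 ν x) * f x with hG
  have hGm : Measurable G := by fun_prop
  have h1 : ∫⁻ e, G (m + r * e) = ENNReal.ofReal r⁻¹ * ∫⁻ x, G x := by
    have h := lintegral_map (μ := (volume : Measure ℝ)) (f := fun x => G (m + x))
      (g := fun e => r * e) (by fun_prop) (by fun_prop)
    rw [← h, Real.map_volume_mul_left hr0.ne', lintegral_smul_measure,
      lintegral_add_left_eq_self, abs_of_pos (inv_pos.2 hr0), smul_eq_mul]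
  rw [h1, ← lintegral_const_mul _ hGm]
  refine lintegral_congr fun x => ?_
  rw [hG]
  simp only
  rw [← mul_assoc, ← ENNReal.ofReal_mul (inv_pos.2 hr0).le, inv_mul_cancel_left₀ hr0.ne']

/-! ### The multivariate t-distribution -/

section Multivariate

variable {ι : Type*} [Fintype ι] [DecidableEq ι]

theorem Matrix.PosDef.inv_quadForm_nonneg {S : Matrix ι ι ℝ} (hS : S.PosDef) (x : ι → ℝ) :
    0 ≤ x ⬝ᵥ (S⁻¹ *ᵥ x) := by
  simpa using hS.inv.posSemidef.dotProduct_mulVec_nonneg x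

theorem studentTPDF_nonneg (m : ι → ℝ) {S : Matrix ι ι ℝ} (hS : S.PosDef) {ν : ℝ} (hν : 2 < ν)
    (x : ι → ℝ) : 0 ≤ studentTPDF m S ν x := by
  have h : 0 < ν - 2 := by linarith
  have h1 := hS.inv_quadForm_nonneg (x - m)
  have := Real.Gamma_pos_of_pos (show 0 < ((Fintype.card ι : ℝ) + ν) / 2 by positivity)
  have := Real.Gamma_pos_of_pos (show 0 < ν / 2 by linarith)
  have := Real.pi_pos
  have := hS.det_pos
  unfold studentTPDF
  positivity

@[fun_prop]
theorem measurable_studentTPDF (m : ι → ℝ) (S : Matrix ι ι ℝ) (ν : ℝ) :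
    Measurable (studentTPDF m S ν) := by
  have h : Measurable fun x : ι → ℝ => (x - m) ⬝ᵥ (S⁻¹ *ᵥ (x - m)) :=
    (by fun_prop : Continuous fun x : ι → ℝ => (x - m) ⬝ᵥ (S⁻¹ *ᵥ (x - m))).measurable
  unfold studentTPDF
  fun_prop

/-- The joint t-density is the product of a marginal and a conditional t-density. -/
theorem studentTPDF_cons {d : ℕ} (m₀ : ℝ) (m : Fin d → ℝ) {s : ℝ} (hs : 0 < s) (b : Fin d → ℝ)
    {S : Matrix (Fin d) (Fin d) ℝ} (hS : S.PosDef) {ν : ℝ} (hν : 2 < ν) (u : ℝ) (x : Fin d → ℝ) :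
    studentTPDF (Matrix.vecCons m₀ m) (schurCov s b S) ν (Matrix.vecCons u x) =
      studentTPDF m S ν x * studentT1PDF (m₀ + b ⬝ᵥ (x - m))
        ((ν - 2 + (x - m) ⬝ᵥ (S⁻¹ *ᵥ (x - m))) / (ν - 2 + d) * s) (ν + d) u := by
  have hSt : Sᵀ = S := by simpa [Matrix.IsHermitian] using hS.isHermitian
  have hA : 0 < ν - 2 := by linarith
  have hq := hS.inv_quadForm_nonneg (x - m)
  have hdet := hS.det_pos
  have hpi := Real.pi_pos
  have hsub : Matrix.vecCons u x - Matrix.vecCons m₀ m = Matrix.vecCons (u - m₀) (x - m) := by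
    simp
  have hcard : ((Fintype.card (Fin (d + 1)) : ℕ) : ℝ) = d + 1 := by simp
  unfold studentTPDF studentT1PDF
  rw [hsub, schurCov_inv_quadForm hs b hS, schurCov_det s b hSt, hcard, Fintype.card_fin]
  set q := (x - m) ⬝ᵥ (S⁻¹ *ᵥ (x - m)) with hqdef
  set c := u - (m₀ + b ⬝ᵥ (x - m)) with hc
  have hc' : u - m₀ - b ⬝ᵥ (x - m) = c := by rw [hc]; ring
  rw [hc']
  have hAq : 0 < ν - 2 + q := by linarith
  have hAd : 0 < ν - 2 + d := by positivity
  -- The reason for the form of the conditional variance: the bracket of the conditional density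
  -- becomes the joint bracket over the marginal one, `W / Q` below.
  have hw : 1 + (ν + d - 2)⁻¹ * (c * (((ν - 2 + q) / (ν - 2 + d) * s)⁻¹ * c)) =
      (1 + (ν - 2)⁻¹ * (c ^ 2 / s + q)) / (1 + (ν - 2)⁻¹ * q) := by
    rw [show ν + d - 2 = ν - 2 + d by ring]
    have : 1 + (ν - 2)⁻¹ * q = (ν - 2 + q) / (ν - 2) := by field_simp
    rw [this]
    field_simp
    ring
  have h1 : 0 < 1 + (ν - 2)⁻¹ * q := by positivity
  have h2 : 0 < 1 + (ν - 2)⁻¹ * (c ^ 2 / s + q) := by positivity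
  have h3 : (ν - 2 + q) = (ν - 2) * (1 + (ν - 2)⁻¹ * q) := by field_simp
  have hG1 := Real.Gamma_pos_of_pos (show 0 < ((d : ℝ) + ν) / 2 by positivity)
  have hG2 := Real.Gamma_pos_of_pos (show 0 < ν / 2 by linarith)
  rw [hw, h3, show ν + (d : ℝ) - 2 = ν - 2 + d by ring, show (ν + (d : ℝ)) / 2 = (d + ν) / 2 by ring,
    show (1 + (ν + (d : ℝ))) / 2 = (d + 1 + ν) / 2 by ring]
  generalize 1 + (ν - 2)⁻¹ * (c ^ 2 / s + q) = W at h2 ⊢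
  generalize 1 + (ν - 2)⁻¹ * q = Q at h1 ⊢
  generalize ν - 2 = A at hA hAd ⊢
  -- What remains is bookkeeping of half powers: `√Q` from `e4` cancels the one from `e2`, and `√(A
  -- + d)` from `e2` the one from `e5`.
  have e1 : (Real.pi * A) ^ (((d : ℝ) + 1) / 2) = (Real.pi * A) ^ ((d : ℝ) / 2) * (√Real.pi * √A) := by
    rw [add_div, Real.rpow_add (by positivity), ← Real.sqrt_eq_rpow, Real.sqrt_mul hpi.le]
  have e2 : ((A * Q) / (A + d) * s) ^ (-(1 / 2) : ℝ) = √(A + d) / (√A * √Q * √s) := by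
    rw [Real.rpow_neg (by positivity), ← Real.sqrt_eq_rpow, Real.sqrt_mul (by positivity),
      Real.sqrt_div (by positivity), Real.sqrt_mul hA.le]
    field_simp
  have e3 : (s * S.det) ^ (-(1 / 2) : ℝ) = (√s)⁻¹ * S.det ^ (-(1 / 2) : ℝ) := by
    rw [Real.mul_rpow hs.le hdet.le, Real.rpow_neg hs.le, ← Real.sqrt_eq_rpow]
  have e4 : (W / Q) ^ (-(((d : ℝ) + 1 + ν) / 2)) =
      W ^ (-(((d : ℝ) + 1 + ν) / 2)) * (√Q / Q ^ (-(((d : ℝ) + ν) / 2))) := by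
    rw [Real.div_rpow h2.le h1.le,
      show -(((d : ℝ) + 1 + ν) / 2) = -(((d : ℝ) + ν) / 2) - 1 / 2 by ring, Real.rpow_sub h1,
      ← Real.sqrt_eq_rpow]
    have := Real.sqrt_pos.2 h1
    field_simp
  have e5 : (Real.pi * (A + d)) ^ (1 / 2 : ℝ) = √Real.pi * √(A + d) := by
    rw [← Real.sqrt_eq_rpow, Real.sqrt_mul hpi.le]
  rw [e1, e2, e3, e4, e5]
  have := Real.sqrt_pos.2 h1
  have := Real.sqrt_pos.2 hA
  have := Real.sqrt_pos.2 hs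
  have := Real.sqrt_pos.2 hpi
  have := Real.sqrt_pos.2 hAd
  have := Real.rpow_pos_of_pos h1 (-(((d : ℝ) + ν) / 2))
  have := Real.rpow_pos_of_pos (mul_pos hpi hA) ((d : ℝ) / 2)
  field_simp

end Multivariate

/-! ### Location-scale transition kernels -/

section LocationScaleKernel

variable {E : Type*} [MeasurableSpace E]

/-- The kernel that sends `x` to the law of `f x + √(g x) * e`, where `e ∼ T`. -/
noncomputable def locScaleKernel (f g : E → ℝ) (T : Measure ℝ) : Kernel E ℝ :=
  (Kernel.id ×ₖ Kernel.const E T).map fun p : E × ℝ => f p.1 + √(g p.1) * p.2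

theorem locScaleKernel_apply {f g : E → ℝ} (hf : Measurable f) (hg : Measurable g) (T : Measure ℝ)
    [SFinite T] (x : E) : locScaleKernel f g T x = T.map fun e => f x + √(g x) * e := by
  rw [locScaleKernel, Kernel.map_apply _ (by fun_prop), Kernel.prod_apply, Kernel.id_apply,
    Kernel.const_apply, Measure.dirac_prod, Measure.map_map (by fun_prop) (by fun_prop)]
  rfl

theorem isMarkovKernel_locScaleKernel {f g : E → ℝ} (hf : Measurable f) (hg : Measurable g)
    (T : Measure ℝ) [IsProbabilityMeasure T] : IsMarkovKernel (locScaleKernel f g T) :=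
  Kernel.IsMarkovKernel.map _ (by fun_prop)

theorem locScaleKernel_studentT1 {f g : E → ℝ} (hf : Measurable f) (hg : Measurable g)
    (hg0 : ∀ x, 0 < g x) {ν : ℝ} (hν : 2 < ν) (x : E) :
    locScaleKernel f g (studentT1 0 1 ν) x = studentT1 (f x) (g x) ν := by
  have := isProbabilityMeasure_studentT1_zero_one hν
  rw [locScaleKernel_apply hf hg, map_studentT1_zero_one _ (hg0 x)]

end LocationScaleKernel

/-- The density factorization as a disintegration: Lebesgue measure splits off the first coordinate,
and Tonelli does the rest. -/
theorem studentT_cons {d : ℕ} (m₀ : ℝ) (m : Fin d → ℝ) {s : ℝ} (hs : 0 < s) (b : Fin d → ℝ)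
    {S : Matrix (Fin d) (Fin d) ℝ} (hS : S.PosDef) {ν : ℝ} (hν : 2 < ν)
    (κ : Kernel (Fin d → ℝ) ℝ) [IsMarkovKernel κ] [SFinite (studentT m S ν)]
    (hκ : ∀ x, κ x = studentT1 (m₀ + b ⬝ᵥ (x - m))
        ((ν - 2 + (x - m) ⬝ᵥ (S⁻¹ *ᵥ (x - m))) / (ν - 2 + d) * s) (ν + d)) :
    ((studentT m S ν) ⊗ₘ κ).map (fun p => (Matrix.vecCons p.2 p.1 : Fin (d + 1) → ℝ)) =
      studentT (Matrix.vecCons m₀ m) (schurCov s b S) ν := by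
  have hcons : Measurable fun p : (Fin d → ℝ) × ℝ => (Matrix.vecCons p.2 p.1 : Fin (d + 1) → ℝ) :=
    measurable_pi_lambda _ fun i => by
      refine Fin.cases ?_ (fun i => ?_) i <;> simp only [Matrix.cons_val_zero, Matrix.cons_val_succ]
      <;> fun_prop
  have hvol := (volume_preserving_piFinSuccAbove (fun _ : Fin (d + 1) => ℝ) 0).symm
  refine Measure.ext_of_lintegral _ fun F hF => ?_
  have hFc : Measurable fun p : (Fin d → ℝ) × ℝ => F (Matrix.vecCons p.2 p.1) := hF.comp hcons
  rw [lintegral_map hF hcons, Measure.lintegral_compProd hFc, studentT, studentT,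
    lintegral_withDensity_eq_lintegral_mul _ (by fun_prop)
      (Measurable.lintegral_kernel_prod_right' hFc),
    lintegral_withDensity_eq_lintegral_mul _ (by fun_prop) hF, ← hvol.lintegral_comp (by fun_prop),
    Measure.volume_eq_prod, lintegral_prod_symm _ (by fun_prop)]
  refine lintegral_congr fun x => ?_
  have hFx : Measurable fun u : ℝ => F (Matrix.vecCons u x) :=
    hF.comp (hcons.comp (measurable_const.prodMk measurable_id))
  simp only [Pi.mul_apply, hκ]
  rw [studentT1, lintegral_withDensity_eq_lintegral_mul _ (by fun_prop) hFx,
    ← lintegral_const_mul _ (by fun_prop)]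
  refine lintegral_congr fun u => ?_
  have he : (MeasurableEquiv.piFinSuccAbove (fun _ : Fin (d + 1) => ℝ) 0).symm (u, x) =
      Matrix.vecCons u x := by
    ext i
    refine Fin.cases ?_ (fun i => ?_) i <;> simp [MeasurableEquiv.piFinSuccAbove]
  rw [he, studentTPDF_cons m₀ m hs b hS hν, ENNReal.ofReal_mul (studentTPDF_nonneg m hS hν x),
    Pi.mul_apply, mul_assoc]

theorem measurable_quadForm {d : ℕ} (m : Fin d → ℝ) (A : Matrix (Fin d) (Fin d) ℝ) :
    Measurable fun x : Fin d → ℝ => (x - m) ⬝ᵥ (A *ᵥ (x - m)) :=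
  (by fun_prop : Continuous fun x : Fin d → ℝ => (x - m) ⬝ᵥ (A *ᵥ (x - m))).measurable

/-- By induction on `d`, the law is the image of a probability measure composed with a Markov
kernel; only the univariate normalization is ever integrated. -/
theorem isProbabilityMeasure_studentT {ν : ℝ} (hν : 2 < ν) : ∀ {d : ℕ} (m : Fin d → ℝ)
    {S : Matrix (Fin d) (Fin d) ℝ}, S.PosDef → IsProbabilityMeasure (studentT m S ν) := by
  intro d
  induction d with
  | zero =>
    intro m S hS
    refine ⟨?_⟩
    have hG := Real.Gamma_pos_of_pos (show 0 < ν / 2 by linarith)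
    have h : ∀ x, studentTPDF m S ν x = 1 := fun x => by
      simp [studentTPDF, hG.ne']
    simp [studentT, h, volume_pi]
  | succ d ih =>
    intro m T hT
    obtain ⟨s, b, S, hs, hS, rfl⟩ := exists_eq_schurCov hT
    have hν' : 2 < ν + d := by
      have : (0 : ℝ) ≤ d := by positivity
      linarith
    have hm : m = Matrix.vecCons (m 0) (fun i => m i.succ) := (Fin.cons_self_tail m).symm
    rw [hm]
    generalize (fun i : Fin d => m i.succ) = m'
    have := isProbabilityMeasure_studentT1_zero_one hν'
    have := ih m' hS
    set f : (Fin d → ℝ) → ℝ := fun x => m 0 + b ⬝ᵥ (x - m')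
    set g : (Fin d → ℝ) → ℝ := fun x =>
      (ν - 2 + (x - m') ⬝ᵥ (S⁻¹ *ᵥ (x - m'))) / (ν - 2 + d) * s
    have hf : Measurable f := (by fun_prop : Continuous f).measurable
    have hg : Measurable g := by
      have := measurable_quadForm m' S⁻¹
      fun_prop
    have hg0 : ∀ x, 0 < g x := fun x => by
      have := hS.inv_quadForm_nonneg (x - m')
      have : 0 < ν - 2 := by linarith
      positivity
    have := isMarkovKernel_locScaleKernel hf hg (studentT1 0 1 (ν + d))
    rw [← studentT_cons (m 0) m' hs b hS hν (locScaleKernel f g (studentT1 0 1 (ν + d)))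
      (locScaleKernel_studentT1 hf hg hg0 hν')]
    refine Measure.isProbabilityMeasure_map (Measurable.aemeasurable ?_)
    refine measurable_pi_lambda _ fun i => ?_
    refine Fin.cases ?_ (fun i => ?_) i <;> simp only [Matrix.cons_val_zero, Matrix.cons_val_succ]
    <;> fun_prop

/-- A t-distribution is invariant under every permutation of the coordinates that fixes its
parameters. -/
theorem map_studentT_comp_equiv {ι : Type*} [Fintype ι] [DecidableEq ι] {m : ι → ℝ}
    {S : Matrix ι ι ℝ} (e : ι ≃ ι) (hm : m ∘ e = m) (hS : S.submatrix e e = S) (ν : ℝ) :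
    (studentT m S ν).map (fun x => x ∘ e) = studentT m S ν := by
  have he : MeasurePreserving (fun x : ι → ℝ => x ∘ e) volume volume := by
    have h := (volume_measurePreserving_piCongrLeft (fun _ : ι => ℝ) e).symm
    exact h
  have hpdf : ∀ x, studentTPDF m S ν (x ∘ e) = studentTPDF m S ν x := fun x => by
    unfold studentTPDF
    have hq : (x ∘ e - m) ⬝ᵥ (S⁻¹ *ᵥ (x ∘ e - m)) = (x - m) ⬝ᵥ (S⁻¹ *ᵥ (x - m)) := by
      have h1 : x ∘ e - m = (x - m) ∘ e := by
        conv_lhs => rw [← hm]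
        rfl
      have h2 : S⁻¹ = S⁻¹.submatrix e e := by
        conv_lhs => rw [← hS, Matrix.inv_submatrix_equiv]
      rw [h1, h2, Matrix.submatrix_mulVec_equiv, ← h2]
      simp only [Function.comp_assoc, Equiv.self_comp_symm, Function.comp_id]
      exact Equiv.sum_comp e fun i => (x - m) i * (S⁻¹ *ᵥ (x - m)) i
    rw [hq]
  refine Measure.ext_of_lintegral _ fun f hf => ?_
  have hfe : Measurable fun x : ι → ℝ => f (x ∘ e) := hf.comp he.measurable
  rw [lintegral_map hf he.measurable, studentT,
    lintegral_withDensity_eq_lintegral_mul _ (by fun_prop) hfe,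
    lintegral_withDensity_eq_lintegral_mul _ (by fun_prop) hf]
  refine Eq.trans (lintegral_congr fun x => ?_) (he.lintegral_comp
    (f := (fun x => ENNReal.ofReal (studentTPDF m S ν x)) * f) (by fun_prop))
  simp [hpdf]

/-- Cauchy–Schwarz in the inner product of `S⁻¹`, applied to `y` and `w = S e_i`. The scalar `l`
makes `l w` the projection of `y` onto `w`. -/
theorem Matrix.PosDef.sq_apply_le {ι : Type*} [Fintype ι] [DecidableEq ι] {S : Matrix ι ι ℝ}
    (hS : S.PosDef) (y : ι → ℝ) (i : ι) : y i ^ 2 ≤ S i i * (y ⬝ᵥ (S⁻¹ *ᵥ y)) := by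
  have hSt : S⁻¹ᵀ = S⁻¹ := by simpa [Matrix.IsHermitian] using hS.inv.isHermitian
  have hSu : IsUnit S.det := (Matrix.isUnit_iff_isUnit_det _).1 hS.isUnit
  have hii : 0 < S i i := hS.diag_pos
  set l := y i / S i i with hl
  set w := S *ᵥ Pi.single i 1 with hw
  have h1 : S⁻¹ *ᵥ w = Pi.single i 1 := by
    rw [hw, Matrix.mulVec_mulVec, Matrix.nonsing_inv_mul _ hSu, Matrix.one_mulVec]
  have h2 : w ⬝ᵥ (S⁻¹ *ᵥ y) = y i := by
    rw [Matrix.dotProduct_mulVec, ← Matrix.mulVec_transpose, hSt, h1, single_one_dotProduct]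
  have h3 : w i = S i i := by simp [hw]
  have h := hS.inv_quadForm_nonneg (y - l • w)
  rw [Matrix.mulVec_sub, Matrix.mulVec_smul, h1, dotProduct_sub, sub_dotProduct, smul_dotProduct,
    h2, dotProduct_smul, sub_dotProduct, smul_dotProduct, dotProduct_single_one,
    dotProduct_single_one, h3, smul_eq_mul, smul_eq_mul, smul_eq_mul] at h
  have h4 : l * S i i = y i := by rw [hl]; field_simp
  rw [h4, sub_self, mul_zero, sub_zero] at h
  calc y i ^ 2 = S i i * (l * y i) := by rw [← mul_assoc, mul_comm (S i i), h4]; ring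
    _ ≤ _ := by gcongr; linarith

theorem Matrix.PosDef.exists_norm_sq_le {ι : Type*} [Fintype ι] [DecidableEq ι] {S : Matrix ι ι ℝ}
    (hS : S.PosDef) : ∃ c : ℝ, 0 < c ∧ ∀ y : ι → ℝ, c * ‖y‖ ^ 2 ≤ y ⬝ᵥ (S⁻¹ *ᵥ y) := by
  have htr : 0 ≤ ∑ i, S i i := Finset.sum_nonneg fun i _ => hS.diag_pos.le
  -- The trace bounds every diagonal entry; the added 1 keeps the constant positive for an empty
  -- index type.
  refine ⟨(1 + ∑ i, S i i)⁻¹, by positivity, fun y => ?_⟩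
  have hq := hS.inv_quadForm_nonneg y
  rw [inv_mul_le_iff₀ (by positivity)]
  have h : ‖y‖ ≤ √((1 + ∑ i, S i i) * (y ⬝ᵥ (S⁻¹ *ᵥ y))) := by
    refine (pi_norm_le_iff_of_nonneg (Real.sqrt_nonneg _)).2 fun i => ?_
    refine Real.abs_le_sqrt ((hS.sq_apply_le y i).trans ?_)
    gcongr
    have := Finset.single_le_sum (f := fun i => S i i) (fun i _ => hS.diag_pos.le)
      (Finset.mem_univ i)
    linarith
  calc ‖y‖ ^ 2 ≤ √((1 + ∑ i, S i i) * (y ⬝ᵥ (S⁻¹ *ᵥ y))) ^ 2 := by gcongr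
    _ = _ := Real.sq_sqrt (by positivity)

/-- The coordinates of a t-distributed vector are square integrable. -/
theorem memLp_eval_studentT {d : ℕ} (m : Fin d → ℝ) {S : Matrix (Fin d) (Fin d) ℝ} (hS : S.PosDef)
    {ν : ℝ} (hν : 2 < ν) (i : Fin d) : MemLp (fun x : Fin d → ℝ => x i) 2 (studentT m S ν) := by
  have := isProbabilityMeasure_studentT hν m hS
  have hA : 0 < ν - 2 := by linarith
  suffices h : MemLp (fun x : Fin d → ℝ => (x - m) i) 2 (studentT m S ν) by
    have h2 := h.add (memLp_const (m i))
    refine h2.ae_eq (Filter.Eventually.of_forall fun x => ?_)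
    simp
  rw [memLp_two_iff_integrable_sq (by fun_prop), studentT,
    integrable_withDensity_iff_integrable_smul' (by fun_prop) (by simp)]
  have h : ∀ x, (ENNReal.ofReal (studentTPDF m S ν x)).toReal • (x - m) i ^ 2 =
      studentTPDF 0 S ν (x - m) * (x - m) i ^ 2 := fun x => by
    rw [ENNReal.toReal_ofReal (studentTPDF_nonneg m hS hν x), smul_eq_mul]
    simp [studentTPDF]
  simp_rw [h]
  refine Integrable.comp_sub_right (f := fun y => studentTPDF 0 S ν y * y i ^ 2) ?_ m
  obtain ⟨c, hc, hcq⟩ := hS.exists_norm_sq_le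
  set a := min 1 ((ν - 2)⁻¹ * c) with ha
  have ha0 : 0 < a := by positivity
  have hlow : ∀ y : Fin d → ℝ, a * (1 + ‖y‖ ^ 2) ≤ 1 + (ν - 2)⁻¹ * (y ⬝ᵥ (S⁻¹ *ᵥ y)) := fun y => by
    have h1 : a * ‖y‖ ^ 2 ≤ (ν - 2)⁻¹ * c * ‖y‖ ^ 2 := by gcongr; exact min_le_right _ _
    have h2 : (ν - 2)⁻¹ * (c * ‖y‖ ^ 2) ≤ (ν - 2)⁻¹ * (y ⬝ᵥ (S⁻¹ *ᵥ y)) := by gcongr; exact hcq y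
    have h3 : a ≤ 1 := min_le_left _ _
    linarith
  set r := ((Fintype.card (Fin d) : ℝ) + ν) / 2 with hr
  have hr0 : 0 < r := by rw [hr]; positivity
  set C := Real.Gamma r / ((Real.pi * (ν - 2)) ^ ((Fintype.card (Fin d) : ℝ) / 2) *
    Real.Gamma (ν / 2)) * S.det ^ (-(1 / 2) : ℝ) with hC
  have hC0 : 0 ≤ C := by
    have := Real.Gamma_pos_of_pos hr0
    have := Real.Gamma_pos_of_pos (show 0 < ν / 2 by linarith)
    have := Real.pi_pos
    have := hS.det_pos
    positivity
  -- The factor `y i ^ 2` costs one power of `1 + ‖y‖ ^ 2`; the remaining exponent `2 (r - 1) = d +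
  -- ν - 2` exceeds `d` exactly because `ν > 2`.
  have hint := integrable_rpow_neg_one_add_norm_sq (E := Fin d → ℝ) (μ := volume)
    (r := 2 * (r - 1)) (by simp [hr]; linarith)
  refine (hint.const_mul (C * a ^ (-r))).mono' (by fun_prop)
    (Filter.Eventually.of_forall fun y => ?_)
  have hy1 : 0 < 1 + ‖y‖ ^ 2 := by positivity
  have hpdf : studentTPDF 0 S ν y ≤ C * (a ^ (-r) * (1 + ‖y‖ ^ 2) ^ (-r)) := by
    rw [studentTPDF, sub_zero, ← Real.mul_rpow ha0.le hy1.le]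
    refine mul_le_mul_of_nonneg_left ?_ hC0
    exact Real.rpow_le_rpow_of_nonpos (by positivity) (hlow y) (by linarith)
  have hyi : y i ^ 2 ≤ 1 + ‖y‖ ^ 2 := by
    have := norm_le_pi_norm y i
    rw [Real.norm_eq_abs] at this
    have h5 : |y i| ^ 2 ≤ ‖y‖ ^ 2 := by gcongr
    rw [sq_abs] at h5
    linarith
  rw [Real.norm_of_nonneg (mul_nonneg (studentTPDF_nonneg 0 hS hν y) (sq_nonneg _))]
  calc studentTPDF 0 S ν y * y i ^ 2
      ≤ C * (a ^ (-r) * (1 + ‖y‖ ^ 2) ^ (-r)) * (1 + ‖y‖ ^ 2) := by gcongr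
    _ = C * a ^ (-r) * ((1 + ‖y‖ ^ 2) ^ (-(2 * (r - 1)) / 2)) := by
      rw [show -(2 * (r - 1)) / 2 = -r + 1 by ring, Real.rpow_add_one hy1.ne']
      ring

/-! ### Conditional expectations of functions of independent variables -/

section Freezing

variable {Ω E : Type*} [mΩ : MeasurableSpace Ω] [MeasurableSpace E] {P : Measure Ω}
  [IsProbabilityMeasure P]

/-- By independence the conditional distribution of `ε` given `X` is a constant kernel. -/
theorem condExp_comap_of_indepFun {β : Type*} [mβ : MeasurableSpace β] {X : Ω → β}
    (hX : Measurable X) {ε : Ω → ℝ} (hε : Measurable ε) (hind : IndepFun X ε P) {Y : β → E}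
    (hY : Measurable Y) {g : E × ℝ → ℝ} (hg : Measurable g)
    (hint : Integrable (fun ω => g (Y (X ω), ε ω)) P) :
    P[fun ω => g (Y (X ω), ε ω) | mβ.comap X] =ᵐ[P] fun ω => ∫ e, g (Y (X ω), e) ∂(P.map ε) := by
  have hf : Measurable fun p : β × ℝ => g (Y p.1, p.2) := by fun_prop
  have := Measure.isProbabilityMeasure_map (μ := P) hε.aemeasurable
  have h1 := condExp_prod_ae_eq_integral_condDistrib hX hε.aemeasurable hf.stronglyMeasurable hint
  have h2 : condDistrib ε X P =ᵐ[P.map X] Kernel.const β (P.map ε) := by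
    refine condDistrib_ae_eq_of_measure_eq_compProd X hε.aemeasurable ?_
    rw [Measure.compProd_const]
    exact (indepFun_iff_map_prod_eq_prod_map_map hX.aemeasurable hε.aemeasurable).1 hind
  filter_upwards [h1, ae_of_ae_map hX.aemeasurable h2] with ω hω1 hω2
  rw [hω1, hω2, Kernel.const_apply]

/-- If `Y` is `m`-measurable and `ε` is independent of `m`, then the conditional expectation of
`g (Y, ε)` given `m` is obtained by integrating over `ε` with `Y` frozen. -/
theorem condExp_of_indep {Ω : Type*} {m mΩ : MeasurableSpace Ω} {P : Measure Ω}
    [IsProbabilityMeasure P] (hm : m ≤ mΩ) {Y : Ω → E} (hY : Measurable[m] Y)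
    {ε : Ω → ℝ} (hε : Measurable ε)
    (hind : Indep (MeasurableSpace.comap ε inferInstance) m P) {g : E × ℝ → ℝ} (hg : Measurable g)
    (hint : Integrable (fun ω => g (Y ω, ε ω)) P) :
    P[fun ω => g (Y ω, ε ω) | m] =ᵐ[P] fun ω => ∫ e, g (Y ω, e) ∂(P.map ε) := by
  -- The sub-σ-algebra `m` is the one generated by the identity map from `Ω` to `(Ω, m)`.
  have hI : @IndepFun Ω Ω ℝ mΩ m _ id ε P := by
    refine (@IndepFun_iff_Indep Ω Ω ℝ mΩ m _ id ε P).2 ?_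
    rw [MeasurableSpace.comap_id]
    exact hind.symm
  have h := @condExp_comap_of_indepFun Ω E mΩ _ P _ Ω m id (measurable_id'' hm) ε hε hI Y hY g hg
    hint
  rwa [MeasurableSpace.comap_id] at h

end Freezing

/-! ### Construction of the process -/

section Construction

variable {q : ℕ}

/-- The vector `(u, x_1, …, x_{p-1})`. -/
def shiftVec {p : ℕ} (u : ℝ) (x : Fin p → ℝ) : Fin p → ℝ :=
  fun i => Matrix.vecCons u x i.castSucc

theorem shiftVec_succ (u : ℝ) (x : Fin (q + 1) → ℝ) (i : Fin q) :
    shiftVec u x i.succ = x i.castSucc := rfl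

theorem measurable_vecCons {α : Type*} [MeasurableSpace α] {p : ℕ} {u : α → ℝ} {x : α → Fin p → ℝ}
    (hu : Measurable u) (hx : Measurable x) :
    Measurable fun a => (Matrix.vecCons (u a) (x a) : Fin (p + 1) → ℝ) := by
  refine measurable_pi_lambda _ fun i => ?_
  refine Fin.cases ?_ (fun i => ?_) i <;> simp only [Matrix.cons_val_zero, Matrix.cons_val_succ]
  <;> fun_prop

theorem measurable_shiftVec {α : Type*} [MeasurableSpace α] {p : ℕ} {u : α → ℝ} {x : α → Fin p → ℝ}
    (hu : Measurable u) (hx : Measurable x) : Measurable fun a => shiftVec (u a) (x a) :=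
  measurable_pi_lambda _ fun i => (measurable_pi_apply i.castSucc).comp (measurable_vecCons hu hx)

/-- The Markov chain driven by the initial value `ω 0` and the errors `ω 1 0, ω 2 0, …`. -/
noncomputable def arChain (f g : (Fin (q + 1) → ℝ) → ℝ) :
    ℕ → (ℕ → Fin (q + 1) → ℝ) → Fin (q + 1) → ℝ
  | 0, ω => ω 0
  | n + 1, ω =>
    shiftVec (f (arChain f g n ω) + √(g (arChain f g n ω)) * ω (n + 1) 0) (arChain f g n ω)

/-- The scalar process whose lag vectors form the chain `arChain`. -/
noncomputable def arProcess (f g : (Fin (q + 1) → ℝ) → ℝ) (t : ℤ) (ω : ℕ → Fin (q + 1) → ℝ) : ℝ :=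
  if 0 ≤ t then arChain f g t.toNat ω 0
  -- Times down to `1 - p = -q` read the initial vector; earlier times carry a dummy value.
  else if h : (-t).toNat < q + 1 then ω 0 ⟨(-t).toNat, h⟩ else 0

/-- The error at time `t`. -/
def arNoise (t : ℤ) (ω : ℕ → Fin (q + 1) → ℝ) : ℝ := ω t.toNat 0

theorem lagVec_arProcess (f g : (Fin (q + 1) → ℝ) → ℝ) (n : ℕ) :
    lagVec (q + 1) (arProcess f g) n = arChain f g n := by
  induction n with
  | zero =>
    funext ω i
    rw [lagVec, arProcess]
    rcases Nat.eq_zero_or_pos (i : ℕ) with hi | hi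
    · rw [if_pos (by omega)]
      have : i = 0 := Fin.ext hi
      subst this
      simp [arChain]
    · rw [if_neg (by omega), dif_pos (by omega)]
      simp only [arChain]
      congr 1
      ext
      simp
  | succ n ih =>
    funext ω i
    refine Fin.cases ?_ (fun i => ?_) i
    · rw [lagVec, arProcess, if_pos (by simp; omega)]
      congr 1
    · have h := congrFun (congrFun ih ω) i.castSucc
      rw [arChain, shiftVec_succ, ← h]
      simp only [lagVec, Fin.val_succ, Fin.val_castSucc]
      congr 1
      push_cast
      ring

theorem arProcess_succ (f g : (Fin (q + 1) → ℝ) → ℝ) (n : ℕ) (ω : ℕ → Fin (q + 1) → ℝ) :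
    arProcess f g ((n : ℤ) + 1) ω =
      f (arChain f g n ω) + √(g (arChain f g n ω)) * arNoise ((n : ℤ) + 1) ω := by
  rw [arProcess, if_pos (by omega)]
  rfl

/-- The σ-algebra generated by the coordinates with index in `s`. -/
abbrev coordSigma (q : ℕ) (s : Set ℕ) : MeasurableSpace (ℕ → Fin (q + 1) → ℝ) :=
  ⨆ k ∈ s, MeasurableSpace.comap (fun ω : ℕ → Fin (q + 1) → ℝ => ω k) inferInstance

theorem coordSigma_mono {s t : Set ℕ} (h : s ⊆ t) : coordSigma q s ≤ coordSigma q t :=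
  biSup_mono h

theorem measurable_coordSigma {s : Set ℕ} {k : ℕ} (hk : k ∈ s) :
    Measurable[coordSigma q s] fun ω : ℕ → Fin (q + 1) → ℝ => ω k :=
  measurable_iff_comap_le.2 (le_iSup₂_of_le k hk le_rfl)

theorem coordSigma_le (s : Set ℕ) : coordSigma q s ≤ MeasurableSpace.pi :=
  iSup₂_le fun k _ => measurable_iff_comap_le.1 (measurable_pi_apply k)

variable {f g : (Fin (q + 1) → ℝ) → ℝ}

theorem measurable_arChain (hf : Measurable f) (hg : Measurable g) (n : ℕ) :
    Measurable[coordSigma q (Set.Iic n)] (arChain f g n) := by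
  induction n with
  | zero => exact measurable_coordSigma (by simp)
  | succ n ih =>
    have h1 : Measurable[coordSigma q (Set.Iic (n + 1))] (arChain f g n) :=
      ih.mono (coordSigma_mono (Set.Iic_subset_Iic.2 n.le_succ)) le_rfl
    have h2 : Measurable[coordSigma q (Set.Iic (n + 1))]
        fun ω : ℕ → Fin (q + 1) → ℝ => ω (n + 1) 0 :=
      (measurable_pi_apply 0).comp (measurable_coordSigma (by simp))
    exact @measurable_shiftVec _ (coordSigma q (Set.Iic (n + 1))) _ _ _
      ((hf.comp h1).add ((hg.comp h1).sqrt.mul h2)) h1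

/-- Negative times have `toNat` equal to 0, in accordance with their values depending on the initial
vector alone. -/
theorem measurable_arProcess (hf : Measurable f) (hg : Measurable g) (t : ℤ) :
    Measurable[coordSigma q (Set.Iic t.toNat)] (arProcess f g t) := by
  unfold arProcess
  split_ifs with h1 h2
  · exact (measurable_pi_apply 0).comp (measurable_arChain hf hg _)
  · exact (measurable_pi_apply _).comp (measurable_coordSigma (by simp))
  · exact @measurable_const _ _ _ (coordSigma q (Set.Iic t.toNat)) _

theorem measurable_arNoise (t : ℤ) : Measurable (arNoise (q := q) t) := by
  unfold arNoise
  fun_prop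

theorem pastSigma_le_coordSigma (hf : Measurable f) (hg : Measurable g) {t : ℤ} (ht : 1 ≤ t) :
    pastSigma (q + 1) (arProcess f g) t ≤ coordSigma q (Set.Iio t.toNat) :=
  iSup₂_le fun s hs => measurable_iff_comap_le.1 ((measurable_arProcess hf hg s).mono
    (coordSigma_mono (Set.Iic_subset_Iio.2 (by have := hs.2; omega))) le_rfl)

theorem measurable_lagVec_pastSigma {Ω : Type*} (p : ℕ) (z : ℤ → Ω → ℝ) {t : ℤ} (ht : 1 ≤ t) :
    Measurable[pastSigma p z t] (lagVec p z (t - 1)) := by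
  refine @measurable_pi_lambda _ _ _ (pastSigma p z t) _ _ fun i => measurable_iff_comap_le.2 ?_
  exact le_iSup₂_of_le (t - 1 - ((i : ℕ) : ℤ)) ⟨by omega, by omega⟩ le_rfl

/-- The law of the initial vector and of the errors. -/
noncomputable def arLaw (ρ : Measure (Fin (q + 1) → ℝ)) (T : Measure ℝ) :
    ℕ → Measure (Fin (q + 1) → ℝ)
  | 0 => ρ
  | _ + 1 => T.map fun u _ => u

instance isProbabilityMeasure_arLaw (ρ : Measure (Fin (q + 1) → ℝ)) (T : Measure ℝ)
    [IsProbabilityMeasure ρ] [IsProbabilityMeasure T] (n : ℕ) :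
    IsProbabilityMeasure (arLaw ρ T n) := by
  cases n with
  | zero => exact inferInstanceAs (IsProbabilityMeasure ρ)
  | succ n => exact Measure.isProbabilityMeasure_map (by fun_prop)

variable (ρ : Measure (Fin (q + 1) → ℝ)) (T : Measure ℝ) [IsProbabilityMeasure ρ]
  [IsProbabilityMeasure T]

theorem map_arNoise {t : ℤ} (ht : 1 ≤ t) :
    (Measure.infinitePi (arLaw ρ T)).map (arNoise t) = T := by
  obtain ⟨n, hn⟩ : ∃ n : ℕ, t.toNat = n + 1 := ⟨t.toNat - 1, by omega⟩
  have h : arNoise (q := q) t = (fun x : Fin (q + 1) → ℝ => x 0) ∘ fun ω => ω t.toNat := rfl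
  rw [h, ← Measure.map_map (by fun_prop) (by fun_prop)]
  erw [Measure.infinitePi_map_eval]
  rw [hn, arLaw, Measure.map_map (by fun_prop) (by fun_prop)]
  exact Measure.map_id

theorem iIndepFun_coord :
    iIndepFun (fun n (ω : ℕ → Fin (q + 1) → ℝ) => ω n) (Measure.infinitePi (arLaw ρ T)) :=
  iIndepFun_infinitePi (P := arLaw ρ T) (X := fun _ x => x) fun _ => measurable_id

theorem iIndepFun_arNoise :
    iIndepFun (fun t : Set.Ici (1 : ℤ) => arNoise (q := q) t) (Measure.infinitePi (arLaw ρ T)) := by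
  have h := (iIndepFun_coord ρ T).comp (fun _ x => x 0) (fun _ => by fun_prop)
  -- `Int.toNat` is injective on times at least 1, though not on all integers.
  exact h.precomp (g := fun t : Set.Ici (1 : ℤ) => (t : ℤ).toNat) fun s t hst => by
    have h1 : (1 : ℤ) ≤ s := s.2
    have h2 : (1 : ℤ) ≤ t := t.2
    have h3 : (s : ℤ).toNat = (t : ℤ).toNat := hst
    exact Subtype.ext (by omega)

theorem indep_arNoise_coordSigma (t : ℤ) :
    Indep (MeasurableSpace.comap (arNoise t) inferInstance) (coordSigma q (Set.Iio t.toNat))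
      (Measure.infinitePi (arLaw ρ T)) := by
  have h := indep_iSup_of_disjoint (fun n => measurable_iff_comap_le.1 (measurable_pi_apply n))
    (iIndepFun_coord ρ T) (S := {t.toNat}) (T := Set.Iio t.toNat) (by simp)
  refine indep_of_indep_of_le_left h ?_
  rw [iSup_singleton]
  have h2 : arNoise (q := q) t = (fun x : Fin (q + 1) → ℝ => x 0) ∘ fun ω => ω t.toNat := rfl
  rw [h2, ← MeasurableSpace.comap_comp]
  exact MeasurableSpace.comap_mono (measurable_iff_comap_le.1 (by fun_prop))

theorem indep_arNoise_pastSigma (hf : Measurable f) (hg : Measurable g) {t : ℤ} (ht : 1 ≤ t) :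
    Indep (MeasurableSpace.comap (arNoise t) inferInstance)
      (pastSigma (q + 1) (arProcess f g) t) (Measure.infinitePi (arLaw ρ T)) :=
  indep_of_indep_of_le_right (indep_arNoise_coordSigma ρ T t) (pastSigma_le_coordSigma hf hg ht)

theorem map_arChain_zero : (Measure.infinitePi (arLaw ρ T)).map (arChain f g 0) = ρ := by
  have h := Measure.infinitePi_map_eval (μ := arLaw ρ T) 0
  exact h

/-- The transition kernel of the chain `arChain`. -/
noncomputable def arKernel (f g : (Fin (q + 1) → ℝ) → ℝ) (T : Measure ℝ) :
    Kernel (Fin (q + 1) → ℝ) (Fin (q + 1) → ℝ) :=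
  (Kernel.id ×ₖ locScaleKernel f g T).map fun p => shiftVec p.2 p.1

theorem arKernel_apply (hf : Measurable f) (hg : Measurable g) (x : Fin (q + 1) → ℝ) :
    arKernel f g T x = (locScaleKernel f g T x).map fun u => shiftVec u x := by
  have := isMarkovKernel_locScaleKernel hf hg T
  rw [arKernel, Kernel.map_apply _ (measurable_shiftVec measurable_snd measurable_fst),
    Kernel.prod_apply, Kernel.id_apply, Measure.dirac_prod,
    Measure.map_map (measurable_shiftVec measurable_snd measurable_fst) (by fun_prop)]
  rfl

theorem isMarkovKernel_arKernel (hf : Measurable f) (hg : Measurable g) :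
    IsMarkovKernel (arKernel f g T) := by
  have := isMarkovKernel_locScaleKernel hf hg T
  exact Kernel.IsMarkovKernel.map _ (measurable_shiftVec measurable_snd measurable_fst)

theorem bind_arKernel (hf : Measurable f) (hg : Measurable g) :
    ρ.bind (arKernel f g T) = (ρ ⊗ₘ locScaleKernel f g T).map fun p => shiftVec p.2 p.1 := by
  have := isMarkovKernel_locScaleKernel hf hg T
  rw [arKernel, ← Measure.map_comp _ _ (measurable_shiftVec measurable_snd measurable_fst),
    Measure.compProd_eq_comp_prod]

theorem map_pair_eq_compProd (hf : Measurable f) (hg : Measurable g) :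
    (ρ.prod T).map (fun p => (p.1, f p.1 + √(g p.1) * p.2)) = ρ ⊗ₘ locScaleKernel f g T := by
  have := isMarkovKernel_locScaleKernel hf hg T
  refine Measure.ext_of_lintegral _ fun F hF => ?_
  rw [lintegral_map hF (by fun_prop), Measure.lintegral_compProd hF,
    lintegral_prod _ (by fun_prop)]
  refine lintegral_congr fun x => ?_
  rw [locScaleKernel_apply hf hg, lintegral_map (by fun_prop) (by fun_prop)]

/-- The state is a function of the coordinates up to `n`, hence independent of the next error. This
joint law supplies both the conditional distribution of `z_t` and the law of `z_t^+`. -/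
theorem map_arChain_arProcess (hf : Measurable f) (hg : Measurable g) (n : ℕ) :
    (Measure.infinitePi (arLaw ρ T)).map
      (fun ω => (arChain f g n ω, arProcess f g ((n : ℤ) + 1) ω)) =
    (Measure.infinitePi (arLaw ρ T)).map (arChain f g n) ⊗ₘ locScaleKernel f g T := by
  have hX : Measurable (arChain f g n) := (measurable_arChain hf hg n).mono (coordSigma_le _) le_rfl
  have hε := measurable_arNoise (q := q) ((n : ℤ) + 1)
  have hind : IndepFun (arChain f g n) (arNoise ((n : ℤ) + 1))
      (Measure.infinitePi (arLaw ρ T)) := by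
    rw [IndepFun_iff_Indep]
    refine indep_of_indep_of_le_left (indep_arNoise_coordSigma ρ T ((n : ℤ) + 1)).symm ?_
    refine (measurable_iff_comap_le.1 (measurable_arChain hf hg n)).trans (coordSigma_mono ?_)
    exact Set.Iic_subset_Iio.2 (by omega)
  have h := (indepFun_iff_map_prod_eq_prod_map_map hX.aemeasurable hε.aemeasurable).1 hind
  rw [map_arNoise ρ T (by omega)] at h
  have := Measure.isProbabilityMeasure_map (μ := Measure.infinitePi (arLaw ρ T)) hX.aemeasurable
  rw [← map_pair_eq_compProd _ T hf hg, ← h, Measure.map_map (by fun_prop) (by fun_prop)]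
  congr 1

theorem map_arChain_succ (hf : Measurable f) (hg : Measurable g) (n : ℕ) :
    (Measure.infinitePi (arLaw ρ T)).map (arChain f g (n + 1)) =
      ((Measure.infinitePi (arLaw ρ T)).map (arChain f g n)).bind (arKernel f g T) := by
  have hX : Measurable (arChain f g n) := (measurable_arChain hf hg n).mono (coordSigma_le _) le_rfl
  have hz : Measurable (arProcess f g ((n : ℤ) + 1)) :=
    (measurable_arProcess hf hg _).mono (coordSigma_le _) le_rfl
  have := Measure.isProbabilityMeasure_map (μ := Measure.infinitePi (arLaw ρ T)) hX.aemeasurable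
  rw [bind_arKernel _ T hf hg, ← map_arChain_arProcess ρ T hf hg n,
    Measure.map_map (measurable_shiftVec measurable_snd measurable_fst) (hX.prodMk hz)]
  congr 1

theorem map_arChain_of_invariant (hf : Measurable f) (hg : Measurable g)
    (hρ : (arKernel f g T).Invariant ρ) (n : ℕ) :
    (Measure.infinitePi (arLaw ρ T)).map (arChain f g n) = ρ := by
  induction n with
  | zero => exact map_arChain_zero ρ T
  | succ n ih => rw [map_arChain_succ ρ T hf hg, ih]; exact hρ

/-- The next state is a function of the current one and of an error independent of the history, so
freezing applies to the indicator of `A`. -/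
theorem isMarkovChain_arChain (hf : Measurable f) (hg : Measurable g) :
    IsMarkovChain (arKernel f g T) (arChain f g) (Measure.infinitePi (arLaw ρ T)) where
  measurable t := (measurable_arChain hf hg t).mono (coordSigma_le _) le_rfl
  condProb t A hA := by
    have hFle : ⨆ s ∈ Set.Iic t, MeasurableSpace.comap (arChain f g s) inferInstance ≤
        coordSigma q (Set.Iio ((t : ℤ) + 1).toNat) :=
      iSup₂_le fun s hs => measurable_iff_comap_le.1 ((measurable_arChain hf hg s).mono
        (coordSigma_mono (Set.Iic_subset_Iio.2 (by have : s ≤ t := hs; omega))) le_rfl)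
    have hY : Measurable[⨆ s ∈ Set.Iic t, MeasurableSpace.comap (arChain f g s) inferInstance]
        (arChain f g t) :=
      measurable_iff_comap_le.2 (le_iSup₂_of_le t (by simp) le_rfl)
    have hstep : Measurable fun p : (Fin (q + 1) → ℝ) × ℝ =>
        shiftVec (f p.1 + √(g p.1) * p.2) p.1 := measurable_shiftVec (by fun_prop) measurable_fst
    set G : (Fin (q + 1) → ℝ) × ℝ → ℝ := fun p =>
      A.indicator (fun _ => (1 : ℝ)) (shiftVec (f p.1 + √(g p.1) * p.2) p.1) with hG
    have hGm : Measurable G := (measurable_const.indicator hA).comp hstep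
    have hXm : Measurable (arChain f g t) := hY.mono (hFle.trans (coordSigma_le _)) le_rfl
    have hεm := measurable_arNoise (q := q) ((t : ℤ) + 1)
    have hint : Integrable (fun ω => G (arChain f g t ω, arNoise ((t : ℤ) + 1) ω))
        (Measure.infinitePi (arLaw ρ T)) := by
      refine Integrable.of_bound (C := 1)
        (hGm.comp (hXm.prodMk hεm)).aestronglyMeasurable (Filter.Eventually.of_forall fun ω => ?_)
      exact (norm_indicator_le_norm_self _ _).trans (by simp)
    have h := condExp_of_indep (hFle.trans (coordSigma_le _)) hY hεm
      (indep_of_indep_of_le_right (indep_arNoise_coordSigma ρ T ((t : ℤ) + 1)) hFle) hGm hint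
    rw [map_arNoise ρ T (by omega)] at h
    refine Filter.EventuallyEq.trans (Filter.EventuallyEq.of_eq ?_) (h.trans
      (Filter.Eventually.of_forall fun ω => ?_))
    · rfl
    · simp only [hG]
      have hA' : Measurable fun e => shiftVec (f (arChain f g t ω) + √(g (arChain f g t ω)) * e)
        (arChain f g t ω) := measurable_shiftVec (by fun_prop) measurable_const
      rw [arKernel_apply T hf hg, locScaleKernel_apply hf hg,
        Measure.map_map (g := fun u => shiftVec u (arChain f g t ω))
          (measurable_shiftVec measurable_id measurable_const) (by fun_prop), Function.comp_def,
        measureReal_def, Measure.map_apply hA' hA, ← measureReal_def,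
        ← integral_indicator_one (hA' hA)]
      rfl

end Construction

/-! ### Conditional mean and variance given the past -/

section ConditionalMoments

variable {q : ℕ} {f g : (Fin (q + 1) → ℝ) → ℝ} (ρ : Measure (Fin (q + 1) → ℝ))
  [IsProbabilityMeasure ρ] {ν : ℝ}

theorem condExp_arProcess (hf : Measurable f) (hg : Measurable g) (hν : 2 < ν) (n : ℕ)
    [IsProbabilityMeasure (studentT1 0 1 ν)]
    (hz : Integrable (arProcess f g ((n : ℤ) + 1))
      (Measure.infinitePi (arLaw ρ (studentT1 0 1 ν)))) :
    (Measure.infinitePi (arLaw ρ (studentT1 0 1 ν)))[arProcess f g ((n : ℤ) + 1) |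
        pastSigma (q + 1) (arProcess f g) ((n : ℤ) + 1)]
      =ᵐ[Measure.infinitePi (arLaw ρ (studentT1 0 1 ν))] fun ω => f (arChain f g n ω) := by
  have ht : (1 : ℤ) ≤ (n : ℤ) + 1 := by omega
  have hzeq : arProcess f g ((n : ℤ) + 1) = fun ω =>
      (fun p : (Fin (q + 1) → ℝ) × ℝ => f p.1 + √(g p.1) * p.2)
        (arChain f g n ω, arNoise ((n : ℤ) + 1) ω) := funext (arProcess_succ f g n)
  have hY := measurable_lagVec_pastSigma (q + 1) (arProcess f g) ht
  rw [add_sub_cancel_right, lagVec_arProcess] at hY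
  have h := condExp_of_indep (P := Measure.infinitePi (arLaw ρ (studentT1 0 1 ν)))
    ((pastSigma_le_coordSigma hf hg ht).trans (coordSigma_le _)) hY
    (measurable_arNoise _) (indep_arNoise_pastSigma ρ (studentT1 0 1 ν) hf hg ht)
    (g := fun p : (Fin (q + 1) → ℝ) × ℝ => f p.1 + √(g p.1) * p.2) (by fun_prop)
    (by rwa [← hzeq])
  rw [← hzeq, map_arNoise ρ _ ht] at h
  refine h.trans (Filter.Eventually.of_forall fun ω => ?_)
  have hid : Integrable (fun e : ℝ => e) (studentT1 0 1 ν) :=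
    (memLp_id_studentT1_zero_one hν).integrable one_le_two
  simp only
  rw [integral_add (integrable_const _) (hid.const_mul _), integral_const_mul,
    integral_id_studentT1_zero_one hν]
  simp

theorem condVar_arProcess (hf : Measurable f) (hg : Measurable g) (hg0 : ∀ x, 0 < g x)
    (hν : 2 < ν) (n : ℕ) [IsProbabilityMeasure (studentT1 0 1 ν)]
    (hz : MemLp (arProcess f g ((n : ℤ) + 1)) 2
      (Measure.infinitePi (arLaw ρ (studentT1 0 1 ν)))) :
    Var[arProcess f g ((n : ℤ) + 1); Measure.infinitePi (arLaw ρ (studentT1 0 1 ν)) |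
        pastSigma (q + 1) (arProcess f g) ((n : ℤ) + 1)]
      =ᵐ[Measure.infinitePi (arLaw ρ (studentT1 0 1 ν))] fun ω => g (arChain f g n ω) := by
  have ht : (1 : ℤ) ≤ (n : ℤ) + 1 := by omega
  have hY := measurable_lagVec_pastSigma (q + 1) (arProcess f g) ht
  rw [add_sub_cancel_right, lagVec_arProcess] at hY
  have hE := condExp_arProcess ρ hf hg hν n (hz.integrable one_le_two)
  have hdiff : (arProcess f g ((n : ℤ) + 1) - (Measure.infinitePi (arLaw ρ (studentT1 0 1 ν)))[
        arProcess f g ((n : ℤ) + 1) | pastSigma (q + 1) (arProcess f g) ((n : ℤ) + 1)]) ^ 2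
      =ᵐ[Measure.infinitePi (arLaw ρ (studentT1 0 1 ν))] fun ω =>
        (fun p : (Fin (q + 1) → ℝ) × ℝ => (√(g p.1) * p.2) ^ 2)
          (arChain f g n ω, arNoise ((n : ℤ) + 1) ω) := by
    filter_upwards [hE] with ω hω
    rw [Pi.pow_apply, Pi.sub_apply, hω, arProcess_succ, add_sub_cancel_left]
  -- Integrability of the squared innovation is inherited from square integrability of `z_t`, with
  -- no moment assumption on `g`.
  have hint := ((hz.sub (hz.condExp one_le_two)).integrable_sq).congr hdiff
  have h := condExp_of_indep (P := Measure.infinitePi (arLaw ρ (studentT1 0 1 ν)))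
    ((pastSigma_le_coordSigma hf hg ht).trans (coordSigma_le _)) hY
    (measurable_arNoise _) (indep_arNoise_pastSigma ρ (studentT1 0 1 ν) hf hg ht)
    (g := fun p : (Fin (q + 1) → ℝ) × ℝ => (√(g p.1) * p.2) ^ 2) (by fun_prop) hint
  rw [map_arNoise ρ _ ht] at h
  refine (condExp_congr_ae hdiff).trans (h.trans (Filter.Eventually.of_forall fun ω => ?_))
  simp only [mul_pow, Real.sq_sqrt (hg0 _).le]
  rw [integral_const_mul, integral_sq_studentT1_zero_one hν, mul_one]

end ConditionalMoments

/-! ### The Student autoregression -/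

section StudentAutoregression

variable {q : ℕ} {φ₀ : ℝ} {φ : Fin (q + 1) → ℝ} {σ ν : ℝ}

theorem measurable_condMeanFun {p : ℕ} (φ₀ : ℝ) (φ : Fin p → ℝ) :
    Measurable (condMeanFun φ₀ φ) := by
  have h : Continuous (condMeanFun φ₀ φ) := by unfold condMeanFun; fun_prop
  exact h.measurable

theorem measurable_condVarFun {p : ℕ} (φ₀ : ℝ) (φ : Fin p → ℝ) (σ ν : ℝ) :
    Measurable (condVarFun φ₀ φ σ ν) := by
  have := measurable_quadForm (fun _ => arMean φ₀ φ) (arCov φ σ)⁻¹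
  unfold condVarFun
  fun_prop

theorem condVarFun_pos (hφ : φ ∈ stationarityRegion (q + 1)) (hσ : 0 < σ) (hν : 2 < ν)
    (x : Fin (q + 1) → ℝ) : 0 < condVarFun φ₀ φ σ ν x := by
  have := (arCov_posDef hφ hσ).inv_quadForm_nonneg (x - fun _ => arMean φ₀ φ)
  have : 0 < ν - 2 := by linarith
  unfold condVarFun
  positivity

/-- The density of `z_t^+` factors into that of `z_{t-1}` and the conditional density of `z_t`. -/
theorem studentT_arCovSucc (hφ : φ ∈ stationarityRegion (q + 1)) (hσ : 0 < σ) (hν : 2 < ν)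
    (hν' : 2 < ν + (q + 1 : ℕ)) [IsProbabilityMeasure (studentT1 0 1 (ν + (q + 1 : ℕ)))]
    [IsProbabilityMeasure (studentT (fun _ : Fin (q + 1) => arMean φ₀ φ) (arCov φ σ) ν)] :
    (studentT (fun _ : Fin (q + 1) => arMean φ₀ φ) (arCov φ σ) ν ⊗ₘ
        locScaleKernel (condMeanFun φ₀ φ) (condVarFun φ₀ φ σ ν)
          (studentT1 0 1 (ν + (q + 1 : ℕ)))).map
        (fun p => (Matrix.vecCons p.2 p.1 : Fin (q + 2) → ℝ)) =
      studentT (fun _ : Fin (q + 2) => arMean φ₀ φ) (arCovSucc φ σ) ν := by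
  have hf := measurable_condMeanFun φ₀ φ
  have hg := measurable_condVarFun φ₀ φ σ ν
  have := isMarkovKernel_locScaleKernel hf hg (studentT1 0 1 (ν + (q + 1 : ℕ)))
  have h := studentT_cons (arMean φ₀ φ) (fun _ => arMean φ₀ φ) (pow_pos hσ 2) φ
    (arCov_posDef hφ hσ) hν (locScaleKernel (condMeanFun φ₀ φ) (condVarFun φ₀ φ σ ν)
    (studentT1 0 1 (ν + (q + 1 : ℕ)))) fun x => by
      rw [locScaleKernel_studentT1 hf hg (condVarFun_pos hφ hσ hν) hν', condMeanFun_eq φ₀ hφ]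
      rfl
  rw [h, ← arCovSucc_eq_schurCov]
  congr 1
  ext i
  refine Fin.cases ?_ (fun i => ?_) i <;> simp

/-- Dropping the newest coordinate recovers the first marginal of the disintegration. -/
theorem studentT_arCovSucc_map_succ (hφ : φ ∈ stationarityRegion (q + 1)) (hσ : 0 < σ)
    (hν : 2 < ν) (hν' : 2 < ν + (q + 1 : ℕ)) :
    (studentT (fun _ : Fin (q + 2) => arMean φ₀ φ) (arCovSucc φ σ) ν).map (fun x => x ∘ Fin.succ) =
      studentT (fun _ : Fin (q + 1) => arMean φ₀ φ) (arCov φ σ) ν := by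
  have := isProbabilityMeasure_studentT1_zero_one hν'
  have := isProbabilityMeasure_studentT hν (fun _ : Fin (q + 1) => arMean φ₀ φ)
    (arCov_posDef hφ hσ)
  have := isMarkovKernel_locScaleKernel (measurable_condMeanFun φ₀ φ)
    (measurable_condVarFun φ₀ φ σ ν) (studentT1 0 1 (ν + (q + 1 : ℕ)))
  rw [← studentT_arCovSucc hφ hσ hν hν', Measure.map_map
    (measurable_pi_lambda _ fun i => by simp only [Function.comp_apply]; fun_prop)
    (measurable_vecCons measurable_snd measurable_fst)]
  exact Measure.fst_compProd _ _

/-- Time reversal preserves both laws and turns dropping the oldest coordinate into dropping the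
newest, the case already settled. -/
theorem studentT_arCovSucc_map_castSucc (hφ : φ ∈ stationarityRegion (q + 1)) (hσ : 0 < σ)
    (hν : 2 < ν) (hν' : 2 < ν + (q + 1 : ℕ)) :
    (studentT (fun _ : Fin (q + 2) => arMean φ₀ φ) (arCovSucc φ σ) ν).map
        (fun x => x ∘ Fin.castSucc) =
      studentT (fun _ : Fin (q + 1) => arMean φ₀ φ) (arCov φ σ) ν := by
  have hmeas : ∀ {m n : ℕ} (e : Fin m → Fin n), Measurable fun x : Fin n → ℝ => x ∘ e :=
    fun e => measurable_pi_lambda _ fun i => measurable_pi_apply (e i)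
  have h1 := map_studentT_comp_equiv (m := fun _ : Fin (q + 2) => arMean φ₀ φ)
    (S := arCovSucc φ σ) Fin.revPerm rfl
    (by ext i j; exact arCovSucc_rev hφ σ i j) ν
  have h2 := map_studentT_comp_equiv (m := fun _ : Fin (q + 1) => arMean φ₀ φ)
    (S := arCov φ σ) Fin.revPerm rfl
    (by ext i j; exact arCov_rev hφ σ i j) ν
  rw [← h1, ← h2, ← studentT_arCovSucc_map_succ hφ hσ hν hν',
    Measure.map_map (hmeas _) (hmeas _), Measure.map_map (hmeas _) (hmeas _)]
  congr 1
  funext x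
  funext i
  simp [Fin.rev_castSucc]

/-- A step of the chain forms `z_t^+` and forgets its oldest coordinate, so invariance is the
preceding marginal identity. -/
theorem arKernel_invariant (hφ : φ ∈ stationarityRegion (q + 1)) (hσ : 0 < σ) (hν : 2 < ν)
    (hν' : 2 < ν + (q + 1 : ℕ)) :
    (arKernel (condMeanFun φ₀ φ) (condVarFun φ₀ φ σ ν)
      (studentT1 0 1 (ν + (q + 1 : ℕ)))).Invariant
      (studentT (fun _ : Fin (q + 1) => arMean φ₀ φ) (arCov φ σ) ν) := by
  have := isProbabilityMeasure_studentT1_zero_one hν'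
  have := isProbabilityMeasure_studentT hν (fun _ : Fin (q + 1) => arMean φ₀ φ)
    (arCov_posDef hφ hσ)
  rw [Kernel.Invariant, bind_arKernel _ _ (measurable_condMeanFun φ₀ φ)
    (measurable_condVarFun φ₀ φ σ ν)]
  conv_rhs => rw [← studentT_arCovSucc_map_castSucc hφ hσ hν hν',
    ← studentT_arCovSucc hφ hσ hν hν', Measure.map_map
      (measurable_pi_lambda _ fun i => by simp only [Function.comp_apply]; fun_prop)
      (measurable_vecCons measurable_snd measurable_fst)]
  rfl

end StudentAutoregression

theorem theorem1 (p : ℕ) (hp : 1 ≤ p) (φ₀ : ℝ) (φ : Fin p → ℝ)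
    (hφ : φ ∈ stationarityRegion p) (σ : ℝ) (hσ : 0 < σ) (ν : ℝ) (hν : 2 < ν) :
    -- the matrices are covariance matrices and the t-density defines a probability distribution
    (arCov φ σ).PosDef ∧ (arCovSucc φ σ).PosDef ∧
    IsProbabilityMeasure (studentT (fun _ : Fin p => arMean φ₀ φ) (arCov φ σ) ν) ∧
    -- there are transition probabilities, with the t-distribution as a stationary distribution,
    ∃ κ : Kernel (Fin p → ℝ) (Fin p → ℝ), IsMarkovKernel κ ∧
      (∀ x, κ x = (studentT1 (condMeanFun φ₀ φ x) (condVarFun φ₀ φ σ ν x) (ν + p)).map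
        fun u => fun i : Fin p => Matrix.vecCons u x i.castSucc) ∧
      κ.Invariant (studentT (fun _ : Fin p => arMean φ₀ φ) (arCov φ σ) ν) ∧
      -- and a process `z_t` (used for `t ≥ 1 - p`) with errors `ε_t` (used for `t ≥ 1`)
      ∃ (Ω : Type) (_ : MeasurableSpace Ω) (z ε : ℤ → Ω → ℝ),
        (∀ t, Measurable (z t)) ∧ (∀ t, Measurable (ε t)) ∧
        -- the autoregressive representation
        (∀ t : ℤ, 1 ≤ t → ∀ ω, 0 < condVarFun φ₀ φ σ ν (lagVec p z (t - 1) ω) ∧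
          z t ω = φ₀ + ∑ i : Fin p, φ i * z (t - (((i : ℕ) : ℤ) + 1)) ω +
            √(condVarFun φ₀ φ σ ν (lagVec p z (t - 1) ω)) * ε t ω) ∧
        -- for every initial distribution `ρ`
        ∀ ρ : Measure (Fin p → ℝ), IsProbabilityMeasure ρ →
          ∃ (P : Measure Ω) (_ : IsProbabilityMeasure P),
            HasLaw (lagVec p z 0) ρ P ∧
            IsMarkovChain κ (fun t : ℕ => lagVec p z (t : ℤ)) P ∧
            -- the errors are IID and independent of the past
            (∀ t : ℤ, 1 ≤ t → HasLaw (ε t) (studentT1 0 1 (ν + p)) P) ∧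
            iIndepFun (fun t : Set.Ici (1 : ℤ) => ε t) P ∧
            (∀ t : ℤ, 1 ≤ t →
              Indep (MeasurableSpace.comap (ε t) inferInstance) (pastSigma p z t) P) ∧
            -- properties of the process started from the stationary distribution
            (ρ = studentT (fun _ : Fin p => arMean φ₀ φ) (arCov φ σ) ν →
              ∀ t : ℤ, 1 ≤ t →
                HasLaw (lagVec p z t)
                  (studentT (fun _ : Fin p => arMean φ₀ φ) (arCov φ σ) ν) P ∧
                HasLaw (fun ω => (Matrix.vecCons (z t ω) (lagVec p z (t - 1) ω) :
                    Fin (p + 1) → ℝ))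
                  (studentT (fun _ : Fin (p + 1) => arMean φ₀ φ) (arCovSucc φ σ) ν) P ∧
                (∀ᵐ x ∂(P.map (lagVec p z (t - 1))),
                  condDistrib (z t) (lagVec p z (t - 1)) P x =
                    studentT1 (condMeanFun φ₀ φ x) (condVarFun φ₀ φ σ ν x) (ν + p)) ∧
                MemLp (z t) 2 P ∧
                P[z t | pastSigma p z t] =ᵐ[P]
                  (fun ω => condMeanFun φ₀ φ (lagVec p z (t - 1) ω)) ∧
                Var[z t; P | pastSigma p z t] =ᵐ[P]
                  (fun ω => condVarFun φ₀ φ σ ν (lagVec p z (t - 1) ω))) := by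
  obtain ⟨q, rfl⟩ : ∃ q, p = q + 1 := ⟨p - 1, by omega⟩
  have hν' : 2 < ν + ((q + 1 : ℕ) : ℝ) := by
    have : (0 : ℝ) ≤ ((q + 1 : ℕ) : ℝ) := Nat.cast_nonneg _
    linarith
  have hS := arCov_posDef hφ hσ
  have hf := measurable_condMeanFun φ₀ φ
  have hg := measurable_condVarFun φ₀ φ σ ν
  have hg0 := condVarFun_pos (φ₀ := φ₀) hφ hσ hν
  have hT := isProbabilityMeasure_studentT1_zero_one hν'
  have hπ := isProbabilityMeasure_studentT hν (fun _ : Fin (q + 1) => arMean φ₀ φ) hS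
  refine ⟨hS, arCovSucc_posDef hφ hσ, hπ,
    arKernel (condMeanFun φ₀ φ) (condVarFun φ₀ φ σ ν) (studentT1 0 1 (ν + (q + 1 : ℕ))),
    isMarkovKernel_arKernel _ hf hg, fun x => ?_, arKernel_invariant hφ hσ hν hν',
    ℕ → Fin (q + 1) → ℝ, inferInstance,
    arProcess (condMeanFun φ₀ φ) (condVarFun φ₀ φ σ ν), arNoise,
    fun t => (measurable_arProcess hf hg t).mono (coordSigma_le _) le_rfl, measurable_arNoise,
    fun t ht ω => ?_, fun ρ hρ => ?_⟩
  · rw [arKernel_apply _ hf hg, locScaleKernel_studentT1 hf hg hg0 hν']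
    rfl
  · obtain ⟨n, rfl⟩ : ∃ n : ℕ, t = (n : ℤ) + 1 := ⟨(t - 1).toNat, by omega⟩
    refine ⟨hg0 _, ?_⟩
    rw [add_sub_cancel_right, lagVec_arProcess, arProcess_succ]
    congr 1
    rw [condMeanFun, dotProduct, ← lagVec_arProcess]
    congr 1
    refine Finset.sum_congr rfl fun i _ => ?_
    rw [lagVec]
    congr 2
    ring
  have hX : ∀ n, Measurable (arChain (condMeanFun φ₀ φ) (condVarFun φ₀ φ σ ν) n) := fun n =>
    (measurable_arChain hf hg n).mono (coordSigma_le _) le_rfl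
  -- Only this measure depends on `ρ`; the process and the errors were fixed before.
  refine ⟨Measure.infinitePi (arLaw ρ (studentT1 0 1 (ν + (q + 1 : ℕ)))), inferInstance, ?_, ?_,
    fun t ht => ⟨(measurable_arNoise t).aemeasurable, map_arNoise _ _ ht⟩,
    iIndepFun_arNoise _ _, fun t ht => indep_arNoise_pastSigma _ _ hf hg ht, fun hρπ t ht => ?_⟩
  · have h := lagVec_arProcess (condMeanFun φ₀ φ) (condVarFun φ₀ φ σ ν) 0
    rw [Nat.cast_zero] at h
    rw [h]
    exact ⟨(hX 0).aemeasurable, map_arChain_zero _ _⟩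
  · simp_rw [lagVec_arProcess]
    exact isMarkovChain_arChain _ _ hf hg
  obtain ⟨n, rfl⟩ : ∃ n : ℕ, t = (n : ℤ) + 1 := ⟨(t - 1).toNat, by omega⟩
  subst hρπ
  have hinv := map_arChain_of_invariant _ _ hf hg (arKernel_invariant (φ₀ := φ₀) hφ hσ hν hν')
  have hz : Measurable (arProcess (condMeanFun φ₀ φ) (condVarFun φ₀ φ σ ν) ((n : ℤ) + 1)) :=
    (measurable_arProcess hf hg _).mono (coordSigma_le _) le_rfl
  have hjoint := map_arChain_arProcess (studentT (fun _ : Fin (q + 1) => arMean φ₀ φ)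
    (arCov φ σ) ν) (studentT1 0 1 (ν + (q + 1 : ℕ))) hf hg n
  have hlaw : HasLaw (lagVec (q + 1) (arProcess (condMeanFun φ₀ φ) (condVarFun φ₀ φ σ ν))
      ((n : ℤ) + 1)) (studentT (fun _ : Fin (q + 1) => arMean φ₀ φ) (arCov φ σ) ν)
      (Measure.infinitePi (arLaw (studentT (fun _ : Fin (q + 1) => arMean φ₀ φ) (arCov φ σ) ν)
        (studentT1 0 1 (ν + (q + 1 : ℕ))))) := by
    have h := lagVec_arProcess (condMeanFun φ₀ φ) (condVarFun φ₀ φ σ ν) (n + 1)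
    rw [Nat.cast_succ] at h
    rw [h]
    exact ⟨(hX _).aemeasurable, hinv _⟩
  have hmem : MemLp (arProcess (condMeanFun φ₀ φ) (condVarFun φ₀ φ σ ν) ((n : ℤ) + 1)) 2
      (Measure.infinitePi (arLaw (studentT (fun _ : Fin (q + 1) => arMean φ₀ φ) (arCov φ σ) ν)
        (studentT1 0 1 (ν + (q + 1 : ℕ))))) := by
    have h := memLp_eval_studentT (fun _ : Fin (q + 1) => arMean φ₀ φ) hS hν 0
    rw [← hlaw.map_eq] at h
    have h2 := h.comp_of_map hlaw.aemeasurable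
    refine h2.ae_eq (Filter.Eventually.of_forall fun ω => ?_)
    simp [lagVec]
  rw [add_sub_cancel_right, lagVec_arProcess]
  have := isMarkovKernel_locScaleKernel hf hg (studentT1 0 1 (ν + (q + 1 : ℕ)))
  refine ⟨hlaw, ⟨(measurable_vecCons hz (hX n)).aemeasurable, ?_⟩, ?_, hmem,
    condExp_arProcess _ hf hg hν' n (hmem.integrable one_le_two),
    condVar_arProcess _ hf hg hg0 hν' n hmem⟩
  · rw [hinv] at hjoint
    rw [← studentT_arCovSucc hφ hσ hν hν', ← hjoint,
      Measure.map_map (measurable_vecCons measurable_snd measurable_fst) ((hX n).prodMk hz)]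
    rfl
  · filter_upwards [condDistrib_ae_eq_of_measure_eq_compProd _ hz.aemeasurable hjoint] with x hx
    rw [hx, locScaleKernel_studentT1 hf hg hg0 hν']
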